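/- Let $\lambda\in(0,\infty)$ and $\beta\in(-1,0)$, and let $\psi:(0,1)\to[0,\infty)$ be a function with $\lim_{x\uparrow1}\psi(x)=\psi_1\in(0,\infty)$ such that $x\mapsto\psi(x)(1-x)^{\beta}$ is a probability density on $(0,1)$. Let $\alpha$ be a random variable with this density, and let $X_0$, $\xi_{k,j}$, $\varepsilon_k$ ($k,j\ge1$) be non-negative integer-valued random variables that are conditionally independent given $\alpha$, such that, conditionally on $\alpha$, $\xi_{k,j}$ is Bernoulli distributed with mean $\alpha$, $\varepsilon_k$ is Poisson distributed with parameter $\lambda$, and $X_0$ is Poisson distributed with parameter $\lambda/(1-\alpha)$. Let $(X_k)_{k\ge0}$ be the randomized INAR(1) process given by $$X_k=\sum_{j=1}^{X_{k-1}}\xi_{k,j}+\varepsilon_k,\qquad k\ge1.$$ Let $(\alpha^{(j)},(X^{(j)}_k)_{k\ge0})$, $j\ge1$, be independent copies of $(\alpha,(X_k)_{k\ge0})$, and for $N,n\ge1$ and $t\ge0$ put $$S^{(N,n)}_t=\sum_{j=1}^{N}\sum_{k=1}^{\lfloor nt\rfloor}\Bigl(X^{(j)}_k-\frac{\lambda}{1-\alpha^{(j)}}\Bigr),$$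 where $\lambda/(1-\alpha^{(j)})$ is the conditional expectation of $X^{(j)}_k$ given $\alpha^{(j)}$. Then for every sequence $(N_n)_{n\ge1}$ of positive integers such that $N_n^{-\beta/(1+\beta)}\,n^{-1}\to\infty$ as $n\to\infty$, the finite-dimensional distributions of the processes $$\Bigl(n^{-1}N_n^{-\frac{1}{2(1+\beta)}}\,S^{(N_n,n)}_t\Bigr)_{t\ge0}$$ converge weakly, as $n\to\infty$, to those of the random line $(V t)_{t\ge0}$, where $V$ is a symmetric $2(1+\beta)$-stable random variable (not depending on $t$) with characteristic function $$\mathbb E\bigl(e^{i\theta V}\bigr)=e^{-K_\beta|\theta|^{2(1+\beta)}},\quad\theta\in\mathbb R,\qquad K_\beta=\psi_1\Bigl(\frac{\lambda}{2}\Bigr)^{1+\beta}\frac{\Gamma(-\beta)}{1+\beta}.$$ -/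

import Mathlib

open MeasureTheory ProbabilityTheory Filter Topology
open scoped NNReal ENNReal

noncomputable section

/-- The random variables `f i`, `i : ι`, are conditionally independent given the sub-σ-algebra `m`:
`P(⋂ i ∈ s, {f i ∈ A i} | m) = ∏ i ∈ s, P(f i ∈ A i | m)` almost surely, for all finite `s` and
all measurable `A i`. (This makes sense on every probability space; on a standard Borel space
it is Mathlib's `iCondIndepFun`, by `iCondIndepFun_iff_condExp_inter_preimage_eq_mul`.) -/
def CondIndepFamily {Ω ι E : Type*} [MeasurableSpace E]
    (m : MeasurableSpace Ω) {_mΩ : MeasurableSpace Ω} (f : ι → Ω → E) (P : Measure Ω) : Prop :=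
  ∀ (s : Finset ι) (A : ι → Set E), (∀ i ∈ s, MeasurableSet (A i)) →
    P⟦⋂ i ∈ s, f i ⁻¹' A i | m⟧ =ᵐ[P] ∏ i ∈ s, P⟦f i ⁻¹' A i | m⟧

/-- Index set of the random variables that drive an INAR(1) process:
the initial value, the Bernoulli variables and the innovations. -/
inductive DriverIndex : Type
  | init : DriverIndex
  | bernoulli (k j : ℕ) : DriverIndex
  | innovation (k : ℕ) : DriverIndex

/-- The family consisting of the initial value `X₀`, of all `ξ k j` and of all `ε k`. -/
def drivers {Ω : Type*} (X₀ : Ω → ℕ) (ξ : ℕ → ℕ → Ω → ℕ) (ε : ℕ → Ω → ℕ) :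
    DriverIndex → Ω → ℕ
  | .init => X₀
  | .bernoulli k j => ξ k j
  | .innovation k => ε k

/-- `X` is a randomized INAR(1) process with random thinning parameter `α` and Poisson innovations
of parameter `lam`, driven by the Bernoulli variables `ξ` and the innovations `ε`. Here `ξ k j`
and `ε k` (with `k j : ℕ` counted from `0`) are the variables that enter the step from time `k` to
time `k + 1`. -/
structure IsRandomizedINAR1 {Ω : Type*} [MeasurableSpace Ω] (P : Measure Ω) (lam : ℝ)
    (α : Ω → ℝ) (ξ : ℕ → ℕ → Ω → ℕ) (ε : ℕ → Ω → ℕ) (X : ℕ → Ω → ℕ) : Prop where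
  measurable_param : Measurable α
  measurable_bernoulli : ∀ k j, Measurable (ξ k j)
  measurable_innovation : ∀ k, Measurable (ε k)
  measurable_init : Measurable (X 0)
  /-- Given `α`, the initial value, the Bernoulli variables and the innovations are independent. -/
  condIndep : CondIndepFamily (MeasurableSpace.comap α inferInstance) (drivers (X 0) ξ ε) P
  /-- Given `α`, the variable `ξ k j` is Bernoulli with mean `α`. -/
  bernoulli_one : ∀ k j,
    P⟦ξ k j ⁻¹' {1} | MeasurableSpace.comap α inferInstance⟧ =ᵐ[P] fun ω => α ω
  bernoulli_zero : ∀ k j,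
    P⟦ξ k j ⁻¹' {0} | MeasurableSpace.comap α inferInstance⟧ =ᵐ[P] fun ω => 1 - α ω
  /-- Given `α`, the innovation `ε k` is Poisson with parameter `lam`. -/
  innovation_law : ∀ k l,
    P⟦ε k ⁻¹' {l} | MeasurableSpace.comap α inferInstance⟧ =ᵐ[P]
      fun _ => lam ^ l / (l.factorial : ℝ) * Real.exp (-lam)
  /-- Given `α`, the initial value is Poisson with parameter `lam / (1 - α)`. -/
  init_law : ∀ l,
    P⟦X 0 ⁻¹' {l} | MeasurableSpace.comap α inferInstance⟧ =ᵐ[P]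
      fun ω => (lam / (1 - α ω)) ^ l / (l.factorial : ℝ) * Real.exp (-(lam / (1 - α ω)))
  /-- The INAR(1) recursion. -/
  recursion : ∀ k ω, X (k + 1) ω = (∑ j ∈ Finset.range (X k ω), ξ k j ω) + ε k ω

/-- The probability measure on `(0, 1)` with density `x ↦ ψ x * (1 - x) ^ β`. -/
def mixingLaw (ψ : ℝ → ℝ) (β : ℝ) : Measure ℝ :=
  (volume.restrict (Set.Ioo (0 : ℝ) 1)).withDensity
    (fun x => ENNReal.ofReal (ψ x * (1 - x) ^ β))

/-- The aggregated centred partial sums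
`S_t^{(N,n)} = ∑_{j=1}^N ∑_{k=1}^{⌊nt⌋} (X_k^{(j)} - lam / (1 - α^{(j)}))`
(the copies are numbered from `0`). -/
def aggregate {Ω : Type*} (lam : ℝ) (α : ℕ → Ω → ℝ) (X : ℕ → ℕ → Ω → ℕ)
    (N n : ℕ) (t : ℝ≥0) (ω : Ω) : ℝ :=
  ∑ j ∈ Finset.range N, ∑ k ∈ Finset.Icc 1 ⌊(n : ℝ≥0) * t⌋₊,
    ((X j k ω : ℝ) - lam / (1 - α j ω))

/-- Convergence of the finite-dimensional distributions of the processes `Y n` (under `P`) to those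
of the process `Z` (under `Q`), as `n → ∞`. -/
def TendstoFDD {Ω Ω' : Type*} [MeasurableSpace Ω] [MeasurableSpace Ω']
    (Y : ℕ → ℝ≥0 → Ω → ℝ) (P : Measure Ω) [IsProbabilityMeasure P]
    (Z : ℝ≥0 → Ω' → ℝ) (Q : Measure Ω') [IsProbabilityMeasure Q] : Prop :=
  ∀ I : Finset ℝ≥0,
    TendstoInDistribution (fun (n : ℕ) (ω : Ω) (t : I) => Y n t ω) atTop
      (fun (ω : Ω') (t : I) => Z t ω) (fun _ => P) Q

/-- The law `ν` on `ℝ` is symmetric and (non-degenerate) `γ`-stable: for independent `V₁, V₂` with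
law `ν` and `a, b > 0`, the variable `a V₁ + b V₂` has the law of `c V₁ + d`, for some `d` and some
`c > 0` with `c ^ γ = a ^ γ + b ^ γ`. -/
structure IsSymmetricStable (γ : ℝ) (ν : Measure ℝ) : Prop where
  index_pos : 0 < γ
  index_le_two : γ ≤ 2
  nondegenerate : ∀ x, ν ≠ Measure.dirac x
  symmetric : ν.map (fun x => -x) = ν
  stable : ∀ a b : ℝ, 0 < a → 0 < b → ∃ c d : ℝ, 0 < c ∧ c ^ γ = a ^ γ + b ^ γ ∧
    (ν.prod ν).map (fun p => a * p.1 + b * p.2) = ν.map (fun x => c * x + d)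

/-- The constant `K_β = ψ₁ (lam / 2) ^ (1 + β) Γ(-β) / (1 + β)`. -/
def stableConst (ψ₁ lam β : ℝ) : ℝ :=
  ψ₁ * (lam / 2) ^ (1 + β) * (Real.Gamma (-β) / (1 + β))

end

noncomputable section

/-! Conditionally on `α = a`, generating functions make the process explicit: a thinning step turns
`u ^ X` into `exp (lam (u - 1)) (1 - a + a u) ^ X`. Eliminating the times from last to first gives
the characteristic function of a centred linear combination `∑ c k X k` as `exp (lam / (1 - a) *
q)`, with `q` the `centredExponent`. Induction gives `q = -(∑ c k) ^ 2 / 2` up to `(∑ |c k|) ^ 3 + K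
(1 - a) (∑ |c k|) ^ 2`, `K` being the number of times (`norm_centredExponent_add_le`).

Put `M = N ^ (1 / (1 + β))` and `T = ∑ θ i t i`. The copies that matter have `1 - α` of order `1 /
M`. Since `n / M → 0`, such a copy barely moves during `n` steps, so its partial sums are nearly
linear in time: this is why the limit is a line. With the normalised coefficients, `M q → -T ^ 2 /
2` at `a = 1 - y / M` (`tendsto_mul_centredExponent`).

Integrating over `α` with the substitution `x = 1 - y / M`, one minus the characteristic function of
one copy is asymptotically `M ^ (-(1 + β)) = 1 / N` times `∫ ψ₁ y ^ β (1 - exp (-lam T ^ 2 / (2 y)))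
dy`, a Gamma integral equal to `K_β |T| ^ (2 (1 + β))` (`tendsto_rpow_mul_integral_mixingLaw`).
Independence raises the characteristic function to the power `N`, which gives `exp (-K_β |T| ^ (2 (1
+ β)))`, the characteristic function of `(V t i)_i` at `θ`. The law of `V` itself is obtained by
tightness, and Lévy's theorem finishes the proof. -/

lemma integral_pow_poissonMeasure (r : ℝ≥0) (u : ℂ) :
    ∫ n, u ^ n ∂(poissonMeasure r) = Complex.exp (r * (u - 1)) := by
  rw [integral_poissonMeasure]
  calc ∑' n : ℕ, (Real.exp (-r) * r ^ n / (n.factorial : ℝ)) • u ^ n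
      = ∑' n : ℕ, (Real.exp (-r) : ℂ) * ((r * u) ^ n / n.factorial) := by
        congr with n
        rw [Complex.real_smul]
        push_cast
        rw [mul_pow]
        ring
    _ = (Real.exp (-r) : ℂ) * Complex.exp (r * u) := by
        rw [tsum_mul_left, (NormedSpace.expSeries_div_hasSum_exp ((r : ℂ) * u)).tsum_eq,
          Complex.exp_eq_exp_ℂ]
    _ = Complex.exp (r * (u - 1)) := by
        rw [Complex.ofReal_exp, ← Complex.exp_add]
        push_cast
        ring_nf

/-! ### The INAR(1) process with a fixed thinning parameter -/

/-- The laws of the driving variables of an INAR(1) process with thinning parameter `a`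
(truncated to `[0, 1]`). -/
def driverLaw (lam a : ℝ) : DriverIndex → Measure ℕ
  | .init => poissonMeasure (lam / (1 - a)).toNNReal
  | .bernoulli _ _ => bernoulliMeasure 1 0 (Set.projIcc (0 : ℝ) 1 zero_le_one a)
  | .innovation _ => poissonMeasure lam.toNNReal

instance (lam a : ℝ) (i : DriverIndex) : IsProbabilityMeasure (driverLaw lam a i) := by
  cases i <;> (unfold driverLaw; infer_instance)

/-- The path of the INAR(1) process as a function of its driving variables. -/
def inarPath (d : DriverIndex → ℕ) : ℕ → ℕ
  | 0 => d .init
  | k + 1 => (∑ j ∈ Finset.range (inarPath d k), d (.bernoulli k j)) + d (.innovation k)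

/-- The indices of the driving variables that enter before time `k`. -/
def pastIndices (k : ℕ) : Set DriverIndex :=
  {i | match i with
    | .init => True
    | .bernoulli m _ => m < k
    | .innovation m => m < k}

/-- The indices of the driving variables of the step from `k` to `k + 1`. -/
def stepIndices (k : ℕ) : Set DriverIndex :=
  {i | match i with
    | .init => False
    | .bernoulli m _ => m = k
    | .innovation m => m = k}

/-- The σ-algebra generated by the coordinates in `S`. -/
@[reducible] def coordSigma (S : Set DriverIndex) : MeasurableSpace (DriverIndex → ℕ) :=
  ⨆ i ∈ S, MeasurableSpace.comap (fun d => d i) inferInstance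

lemma coordSigma_le (S : Set DriverIndex) : coordSigma S ≤ MeasurableSpace.pi :=
  iSup₂_le fun i _ => (measurable_pi_apply i).comap_le

lemma coordSigma_mono {S T : Set DriverIndex} (h : S ⊆ T) : coordSigma S ≤ coordSigma T :=
  biSup_mono h

lemma measurable_coord {S : Set DriverIndex} {i : DriverIndex} (hi : i ∈ S) :
    Measurable[coordSigma S] (fun d : DriverIndex → ℕ => d i) :=
  Measurable.of_comap_le (le_iSup₂_of_le i hi le_rfl)

lemma disjoint_pastIndices_stepIndices (k : ℕ) : Disjoint (pastIndices k) (stepIndices k) := by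
  rw [Set.disjoint_left]
  intro i hi hi'
  cases i <;> simp [pastIndices, stepIndices] at hi hi' <;> omega

lemma pastIndices_mono {k l : ℕ} (h : k ≤ l) : pastIndices k ⊆ pastIndices l := by
  intro i hi
  cases i <;> simp [pastIndices] at hi ⊢ <;> omega

/-- The value after the step from `k` to `k + 1`, started from the value `l`. -/
def stepValue (k : ℕ) (d : DriverIndex → ℕ) (l : ℕ) : ℕ :=
  (∑ j ∈ Finset.range l, d (.bernoulli k j)) + d (.innovation k)

lemma inarPath_succ (d : DriverIndex → ℕ) (k : ℕ) :
    inarPath d (k + 1) = stepValue k d (inarPath d k) := rfl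

lemma measurable_stepValue (k : ℕ) : Measurable[coordSigma (stepIndices k)] (stepValue k) := by
  refine @measurable_pi_lambda _ _ _ (coordSigma (stepIndices k)) _ _ fun l => ?_
  refine Measurable.add ?_ ?_
  · exact Finset.measurable_fun_sum _ fun j _ => measurable_coord (by simp [stepIndices])
  · exact measurable_coord (by simp [stepIndices])

lemma measurable_inarPath_past (k : ℕ) :
    Measurable[coordSigma (pastIndices k)] (fun d => inarPath d k) := by
  induction k with
  | zero => exact measurable_coord (by simp [pastIndices])
  | succ k ih =>
    have h1 : Measurable[coordSigma (pastIndices (k + 1))] (fun d => inarPath d k) :=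
      ih.mono (coordSigma_mono (pastIndices_mono k.le_succ)) le_rfl
    have h2 : Measurable[coordSigma (pastIndices (k + 1))] (stepValue k) :=
      (measurable_stepValue k).mono (coordSigma_mono fun i hi => by
        cases i <;> simp [pastIndices, stepIndices] at hi ⊢ <;> omega) le_rfl
    have h3 : Measurable (fun p : ℕ × (ℕ → ℕ) => p.2 p.1) :=
      measurable_from_prod_countable_right fun l => measurable_pi_apply l
    exact h3.comp (Measurable.prodMk h1 h2)

lemma measurable_inarPath (k : ℕ) : Measurable (fun d => inarPath d k) :=
  (measurable_inarPath_past k).mono (coordSigma_le _) le_rfl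

/-- The law of the family of driving variables with thinning parameter `a`. -/
abbrev driversLaw (lam a : ℝ) : Measure (DriverIndex → ℕ) :=
  Measure.infinitePi (driverLaw lam a)

lemma iIndepFun_coord (lam a : ℝ) :
    iIndepFun (fun (i : DriverIndex) (d : DriverIndex → ℕ) => d i) (driversLaw lam a) :=
  iIndepFun_infinitePi (X := fun _ => id) (fun _ => measurable_id)

lemma integral_coord {lam a : ℝ} (i : DriverIndex) (f : ℕ → ℂ) :
    ∫ d, f (d i) ∂(driversLaw lam a) = ∫ n, f n ∂(driverLaw lam a i) := by
  rw [← Measure.infinitePi_map_eval (driverLaw lam a) i,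
    integral_map (measurable_pi_apply i).aemeasurable
      (measurable_of_countable f).aestronglyMeasurable]

lemma integral_pow_stepValue {lam a : ℝ} (hlam : 0 ≤ lam) (ha : a ∈ Set.Icc (0 : ℝ) 1)
    (k l : ℕ) (u : ℂ) :
    ∫ d, u ^ stepValue k d l ∂(driversLaw lam a)
      = Complex.exp (lam * (u - 1)) * (1 - a + a * u) ^ l := by
  set e : Option (Fin l) → DriverIndex :=
    fun o => o.elim (.innovation k) (fun j => .bernoulli k j) with he
  have hinj : Function.Injective e := by
    rintro (_ | i) (_ | j) h <;> simp [he] at h ⊢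
    omega
  have hind := (iIndepFun_coord lam a).precomp hinj
  have h1 : ∀ d : DriverIndex → ℕ, u ^ stepValue k d l = ∏ o : Option (Fin l), u ^ (d (e o)) := by
    intro d
    rw [Finset.prod_pow_eq_pow_sum, Fintype.sum_option, stepValue, Finset.sum_range, add_comm]
    rfl
  simp_rw [h1]
  rw [hind.integral_fun_prod_comp (f := fun _ n => u ^ n) 
    (fun o => (measurable_pi_apply (e o)).aemeasurable)
    (fun o => (measurable_of_countable _).aestronglyMeasurable), Fintype.prod_option]
  congr 1
  · rw [integral_coord _ (fun n => u ^ n)]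
    simp only [he, Option.elim, driverLaw]
    rw [integral_pow_poissonMeasure, Real.coe_toNNReal _ hlam]
  · simp_rw [integral_coord _ (fun n => u ^ n)]
    simp only [he, Option.elim, driverLaw]
    rw [integral_bernoulliMeasure, Finset.prod_const, Finset.card_univ, Fintype.card_fin]
    rw [Set.projIcc_of_mem _ ha]
    congr 1
    simp
    ring

lemma norm_pow_le_one_of_norm_le_one {u : ℂ} (hu : ‖u‖ ≤ 1) (n : ℕ) : ‖u ^ n‖ ≤ 1 := by
  rw [norm_pow]
  exact pow_le_one₀ (norm_nonneg _) hu

/-- The step is treated as a random function `ℕ → ℕ` independent of the past. Fubini then freezes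
the past, in particular the random number of summands, and the generating function of a step with a
deterministic start applies. -/
lemma integral_mul_pow_inarPath_succ {lam a : ℝ} (hlam : 0 ≤ lam) (ha : a ∈ Set.Icc (0 : ℝ) 1)
    (k : ℕ) {u : ℂ} (hu : ‖u‖ ≤ 1) {G : (DriverIndex → ℕ) → ℂ}
    (hG : Measurable[coordSigma (pastIndices k)] G) (hG1 : ∀ d, ‖G d‖ ≤ 1) :
    ∫ d, G d * u ^ inarPath d (k + 1) ∂(driversLaw lam a)
      = Complex.exp (lam * (u - 1)) *
        ∫ d, G d * (1 - a + a * u) ^ inarPath d k ∂(driversLaw lam a) := by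
  set μ := driversLaw lam a
  set F : (DriverIndex → ℕ) → ℂ × ℕ := fun d => (G d, inarPath d k) with hF
  have hFm : Measurable[coordSigma (pastIndices k)] F :=
    Measurable.prodMk hG (measurable_inarPath_past k)
  have hFm' : Measurable F := hFm.mono (coordSigma_le _) le_rfl
  have hYm : Measurable (stepValue k) := (measurable_stepValue k).mono (coordSigma_le _) le_rfl
  have hind : IndepFun F (stepValue k) μ := by
    have := indep_iSup_of_disjoint (fun i => (measurable_pi_apply i).comap_le)
      (iIndepFun_coord lam a) (disjoint_pastIndices_stepIndices k)
    exact indep_of_indep_of_le_left (indep_of_indep_of_le_right this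
      (measurable_stepValue k).comap_le) hFm.comap_le
  have hprod := hind.map_prod_eq_prod_map_map hFm'.aemeasurable hYm.aemeasurable
  have hFp : IsProbabilityMeasure (μ.map F) := Measure.isProbabilityMeasure_map hFm'.aemeasurable
  have hYp : IsProbabilityMeasure (μ.map (stepValue k)) :=
    Measure.isProbabilityMeasure_map hYm.aemeasurable
  set H : (ℂ × ℕ) × (ℕ → ℕ) → ℂ := fun p => p.1.1 * u ^ (p.2 p.1.2) with hH
  have hHm : Measurable H := by
    have h3 : Measurable (fun p : ℕ × (ℕ → ℕ) => p.2 p.1) :=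
      measurable_from_prod_countable_right fun l => measurable_pi_apply l
    have h4 : Measurable (fun p : (ℂ × ℕ) × (ℕ → ℕ) => p.2 p.1.2) :=
      h3.comp ((measurable_snd.comp measurable_fst).prodMk measurable_snd)
    exact (measurable_fst.comp measurable_fst).mul
      ((measurable_of_countable (fun n : ℕ => u ^ n)).comp h4)
  have hHi : Integrable H ((μ.map F).prod (μ.map (stepValue k))) := by
    rw [← hprod, integrable_map_measure hHm.aestronglyMeasurable (hFm'.prodMk hYm).aemeasurable]
    refine Integrable.of_bound (C := 1) (hHm.comp (hFm'.prodMk hYm)).aestronglyMeasurable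
      (ae_of_all _ fun d => ?_)
    simp only [hH, hF, Function.comp, norm_mul]
    exact mul_le_one₀ (hG1 d) (norm_nonneg _) (norm_pow_le_one_of_norm_le_one hu _)
  calc ∫ d, G d * u ^ inarPath d (k + 1) ∂μ
      = ∫ d, H (F d, stepValue k d) ∂μ := rfl
    _ = ∫ p, H p ∂((μ.map F).prod (μ.map (stepValue k))) := by
        rw [← hprod, integral_map (hFm'.prodMk hYm).aemeasurable hHm.aestronglyMeasurable]
    _ = ∫ x, ∫ y, H (x, y) ∂(μ.map (stepValue k)) ∂(μ.map F) := integral_prod _ hHi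
    _ = ∫ x, Complex.exp (lam * (u - 1)) * (x.1 * (1 - a + a * u) ^ x.2) ∂(μ.map F) := by
        congr 1 with x
        simp only [hH]
        have hm : AEStronglyMeasurable (fun y : ℕ → ℕ => u ^ y x.2) (μ.map (stepValue k)) :=
          ((measurable_of_countable (fun n : ℕ => u ^ n)).comp
            (measurable_pi_apply x.2)).aestronglyMeasurable
        rw [integral_const_mul, integral_map hYm.aemeasurable hm,
          integral_pow_stepValue hlam ha]
        ring
    _ = _ := by
        rw [integral_const_mul, integral_map hFm'.aemeasurable]
        exact (measurable_fst.mul ((measurable_of_countable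
          (fun n : ℕ => (1 - a + a * u) ^ n)).comp measurable_snd)).aestronglyMeasurable

/-! ### The joint characteristic function given the thinning parameter -/

/-- The number `v` such that the conditional expectation of `exp (i ∑_{k < K} c k X_{m + k})`
given the past up to time `m` is proportional to `(1 + v) ^ X_m`. -/
def genDev (a : ℝ) : ℕ → (ℕ → ℝ) → ℂ
  | 0, _ => 0
  | K + 1, c => (Complex.exp (c 0 * Complex.I) - 1) * (1 + a * genDev a K fun k => c (k + 1))
      + a * genDev a K fun k => c (k + 1)

/-- The contribution of the innovations to the logarithm of the joint characteristic function. -/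
def genRate (a : ℝ) : ℕ → (ℕ → ℝ) → ℂ
  | 0, _ => 0
  | K + 1, c => genDev a K (fun k => c (k + 1)) + genRate a K fun k => c (k + 1)

/-- The logarithm of the joint characteristic function of the centred process, divided by the mean
of the process. -/
def centredExponent (a : ℝ) : ℕ → (ℕ → ℝ) → ℂ
  | 0, _ => 0
  | K + 1, c => (Complex.exp (c 0 * Complex.I) - 1) * (1 + a * genDev a K fun k => c (k + 1))
      - c 0 * Complex.I + centredExponent a K fun k => c (k + 1)

/-- Initial value, innovations and centring contribute `lam / (1 - a)` times the three terms on the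
right. Their sum satisfies a recursion whose increments are already of second order in `c`, so the
cancellation of first-order terms is built into `centredExponent`. -/
lemma centredExponent_eq (a : ℝ) (K : ℕ) (c : ℕ → ℝ) :
    centredExponent a K c = genDev a K c + (1 - a) * genRate a K c
      - (∑ k ∈ Finset.range K, c k : ℝ) * Complex.I := by
  induction K generalizing c with
  | zero => simp [centredExponent, genDev, genRate]
  | succ K ih =>
    rw [centredExponent, genDev, genRate, ih, Finset.sum_range_succ']
    push_cast
    ring

lemma norm_one_add_mul_le {a : ℝ} (ha : a ∈ Set.Icc (0 : ℝ) 1) {v : ℂ} (hv : ‖1 + v‖ ≤ 1) :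
    ‖1 + a * v‖ ≤ 1 := by
  calc ‖1 + a * v‖ = ‖((1 - a : ℝ) : ℂ) + (a : ℂ) * (1 + v)‖ := by push_cast; ring_nf
    _ ≤ ‖((1 - a : ℝ) : ℂ)‖ + ‖(a : ℂ) * (1 + v)‖ := norm_add_le _ _
    _ ≤ (1 - a) + a * 1 := by
        rw [norm_mul, Complex.norm_real, Complex.norm_real, Real.norm_of_nonneg ha.1,
          Real.norm_of_nonneg (sub_nonneg.2 ha.2)]
        gcongr
        exact ha.1
    _ = 1 := by ring

/-- Keeps the bases of the powers in the closed unit disc, as integrability in each conditioning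
step requires: `1 + a v` is a convex combination of `1` and `1 + v`. -/
lemma norm_one_add_genDev_le {a : ℝ} (ha : a ∈ Set.Icc (0 : ℝ) 1) (K : ℕ) (c : ℕ → ℝ) :
    ‖1 + genDev a K c‖ ≤ 1 := by
  induction K generalizing c with
  | zero => simp [genDev]
  | succ K ih =>
    have : 1 + genDev a (K + 1) c
        = Complex.exp (c 0 * Complex.I) * (1 + a * genDev a K fun k => c (k + 1)) := by
      rw [genDev]; ring
    rw [this, norm_mul, Complex.norm_exp_ofReal_mul_I, one_mul]
    exact norm_one_add_mul_le ha (ih _)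

/-- The bounded past factor `G` is what makes the induction close: the factor of time `m` is
absorbed into `G`, the later times are handled by the induction hypothesis from `m + 1`, and
conditioning on the past up to `m` brings the power of `X_{m + 1}` back to one of `X_m`. -/
lemma integral_mul_exp_sum_inarPath {lam a : ℝ} (hlam : 0 ≤ lam) (ha : a ∈ Set.Icc (0 : ℝ) 1)
    (K m : ℕ) (c : ℕ → ℝ) {G : (DriverIndex → ℕ) → ℂ}
    (hG : Measurable[coordSigma (pastIndices m)] G) (hG1 : ∀ d, ‖G d‖ ≤ 1) :
    ∫ d, G d * Complex.exp ((∑ k ∈ Finset.range K, c k * inarPath d (m + k) : ℝ) * Complex.I)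
        ∂(driversLaw lam a)
      = Complex.exp (lam * genRate a K c) *
        ∫ d, G d * (1 + genDev a K c) ^ inarPath d m ∂(driversLaw lam a) := by
  induction K generalizing m c G with
  | zero => simp [genRate, genDev]
  | succ K ih =>
    set c' : ℕ → ℝ := fun k => c (k + 1)
    set G' : (DriverIndex → ℕ) → ℂ :=
      fun d => G d * Complex.exp ((c 0 * inarPath d m : ℝ) * Complex.I) with hG'
    have hG'm : Measurable[coordSigma (pastIndices m)] G' :=
      Measurable.mul hG ((measurable_of_countable
        (fun n : ℕ => Complex.exp ((c 0 * n : ℝ) * Complex.I))).comp (measurable_inarPath_past m))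
    have hG'1 : ∀ d, ‖G' d‖ ≤ 1 := fun d => by
      rw [hG', norm_mul, Complex.norm_exp_ofReal_mul_I, mul_one]
      exact hG1 d
    have h1 : ∀ d, G d * Complex.exp
          ((∑ k ∈ Finset.range (K + 1), c k * inarPath d (m + k) : ℝ) * Complex.I)
        = G' d * Complex.exp
          ((∑ k ∈ Finset.range K, c' k * inarPath d (m + 1 + k) : ℝ) * Complex.I) := by
      intro d
      rw [Finset.sum_range_succ', hG', mul_assoc, ← Complex.exp_add]
      congr 2
      have h : ∀ k, c (k + 1) * inarPath d (m + (k + 1)) = c' k * inarPath d (m + 1 + k) :=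
        fun k => by rw [add_assoc m 1 k, add_comm 1 k]
      rw [Finset.sum_congr rfl fun k _ => h k]
      push_cast
      ring_nf
    simp_rw [h1]
    rw [ih (m + 1) c' (hG'm.mono (coordSigma_mono (pastIndices_mono m.le_succ)) le_rfl) hG'1,
      integral_mul_pow_inarPath_succ hlam ha m (norm_one_add_genDev_le ha K c') hG'm hG'1,
      ← mul_assoc, ← Complex.exp_add]
    congr 1
    · rw [genRate]
      congr 1
      ring
    · congr 1 with d
      rw [hG', mul_assoc]
      congr 1
      have : 1 + genDev a (K + 1) c
          = Complex.exp (c 0 * Complex.I) * (1 - a + a * (1 + genDev a K c')) := by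
        rw [genDev]; ring
      rw [this, mul_pow, ← Complex.exp_nat_mul]
      congr 2
      push_cast
      ring

/-- The joint characteristic function of the stationary INAR(1) process, centred at its mean. -/
lemma integral_exp_sum_centred_inarPath {lam a : ℝ} (hlam : 0 ≤ lam)
    (ha : a ∈ Set.Ioo (0 : ℝ) 1) (K : ℕ) (c : ℕ → ℝ) :
    ∫ d, Complex.exp ((∑ k ∈ Finset.range K, c k * (inarPath d k - lam / (1 - a)) : ℝ)
        * Complex.I) ∂(driversLaw lam a)
      = Complex.exp ((lam / (1 - a) : ℝ) * centredExponent a K c) := by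
  have h1a : 0 < 1 - a := by linarith [ha.2]
  have h1 : ∀ d : DriverIndex → ℕ,
      Complex.exp ((∑ k ∈ Finset.range K, c k * (inarPath d k - lam / (1 - a)) : ℝ) * Complex.I)
      = Complex.exp (-((lam / (1 - a) : ℝ) * ((∑ k ∈ Finset.range K, c k : ℝ) * Complex.I)))
        * (1 * Complex.exp
          ((∑ k ∈ Finset.range K, c k * inarPath d (0 + k) : ℝ) * Complex.I)) := by
    intro d
    rw [one_mul, ← Complex.exp_add]
    congr 1
    simp only [mul_sub, Finset.sum_sub_distrib, ← Finset.sum_mul, zero_add]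
    push_cast
    ring
  simp_rw [h1]
  rw [integral_const_mul, integral_mul_exp_sum_inarPath hlam ⟨ha.1.le, ha.2.le⟩ K 0 c
    (G := fun _ => 1) measurable_const (by simp)]
  simp only [one_mul]
  have h2 : ∫ d, (1 + genDev a K c) ^ inarPath d 0 ∂(driversLaw lam a)
      = Complex.exp ((lam / (1 - a) : ℝ) * genDev a K c) := by
    refine (integral_coord .init (fun n => (1 + genDev a K c) ^ n)).trans ?_
    rw [driverLaw, integral_pow_poissonMeasure, Real.coe_toNNReal _ (by positivity)]
    congr 1
    ring
  rw [h2, ← Complex.exp_add, ← Complex.exp_add, centredExponent_eq]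
  congr 1
  have : ((lam / (1 - a) : ℝ) : ℂ) * (1 - a) = lam := by
    have : (1 - a : ℂ) ≠ 0 := by exact_mod_cast h1a.ne'
    push_cast
    field_simp
  linear_combination (-genRate a K c) * this

/-! ### Estimates for the exponent -/

lemma norm_exp_mul_I_sub_one_le (x : ℝ) : ‖Complex.exp (x * Complex.I) - 1‖ ≤ |x| := by
  simpa [mul_comm] using Real.norm_exp_I_mul_ofReal_sub_one_le (x := x)

/-- Mean value inequality on the segment from `0` to `x`, with the previous bound for the
derivative. The constants here and in the next lemma are not sharp; only the orders matter. -/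
lemma norm_exp_mul_I_sub_one_sub_le (x : ℝ) :
    ‖Complex.exp (x * Complex.I) - 1 - x * Complex.I‖ ≤ x ^ 2 := by
  have hd : ∀ y ∈ Set.uIcc 0 x, HasDerivWithinAt
      (fun y : ℝ => Complex.exp (y * Complex.I) - 1 - y * Complex.I)
      (Complex.I * (Complex.exp (y * Complex.I) - 1)) (Set.uIcc 0 x) y := by
    intro y _
    have h1 : HasDerivAt (fun y : ℝ => (y : ℂ) * Complex.I) Complex.I y := by
      simpa using (Complex.ofRealCLM.hasDerivAt (x := y)).mul_const Complex.I
    exact (((h1.cexp.sub_const 1).sub h1).congr_deriv (by ring)).hasDerivWithinAt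
  have hb : ∀ y ∈ Set.uIcc 0 x, ‖Complex.I * (Complex.exp (y * Complex.I) - 1)‖ ≤ |x| := by
    intro y hy
    rw [norm_mul, Complex.norm_I, one_mul]
    refine (norm_exp_mul_I_sub_one_le y).trans ?_
    simpa using Set.abs_sub_left_of_mem_uIcc hy
  have := (convex_uIcc 0 x).norm_image_sub_le_of_norm_hasDerivWithin_le hd hb
    Set.left_mem_uIcc Set.right_mem_uIcc
  simpa [← sq] using this

lemma norm_exp_mul_I_sub_one_sub_add_le (x : ℝ) :
    ‖Complex.exp (x * Complex.I) - 1 - x * Complex.I + x ^ 2 / 2‖ ≤ |x| ^ 3 := by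
  have hd : ∀ y ∈ Set.uIcc 0 x, HasDerivWithinAt
      (fun y : ℝ => Complex.exp (y * Complex.I) - 1 - y * Complex.I + (y : ℂ) ^ 2 / 2)
      (Complex.I * (Complex.exp (y * Complex.I) - 1 - y * Complex.I)) (Set.uIcc 0 x) y := by
    intro y _
    have h0 := Complex.ofRealCLM.hasDerivAt (x := y)
    have h1 : HasDerivAt (fun y : ℝ => (y : ℂ) * Complex.I) Complex.I y := by
      simpa using h0.mul_const Complex.I
    refine ((((h1.cexp.sub_const 1).sub h1).add ((h0.pow 2).div_const 2)).congr_deriv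
      ?_).hasDerivWithinAt
    simp
    linear_combination (y : ℂ) * Complex.I_sq
  have hb : ∀ y ∈ Set.uIcc 0 x,
      ‖Complex.I * (Complex.exp (y * Complex.I) - 1 - y * Complex.I)‖ ≤ |x| ^ 2 := by
    intro y hy
    rw [norm_mul, Complex.norm_I, one_mul]
    refine (norm_exp_mul_I_sub_one_sub_le y).trans ?_
    rw [← sq_abs y]
    have : |y| ≤ |x| := by simpa using Set.abs_sub_left_of_mem_uIcc hy
    gcongr
  have := (convex_uIcc 0 x).norm_image_sub_le_of_norm_hasDerivWithin_le hd hb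
    Set.left_mem_uIcc Set.right_mem_uIcc
  rw [pow_succ |x|]
  simpa only [Complex.ofReal_zero, zero_mul, Complex.exp_zero, sub_self, sub_zero, ne_eq,
    OfNat.ofNat_ne_zero, not_false_eq_true, zero_pow, zero_div, add_zero, Real.norm_eq_abs]
    using this

lemma norm_genDev_le {a : ℝ} (ha : a ∈ Set.Icc (0 : ℝ) 1) (K : ℕ) (c : ℕ → ℝ) :
    ‖genDev a K c‖ ≤ ∑ k ∈ Finset.range K, |c k| := by
  induction K generalizing c with
  | zero => simp [genDev]
  | succ K ih =>
    rw [genDev, Finset.sum_range_succ']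
    set v := genDev a K fun k => c (k + 1)
    have h1 : ‖1 + a * v‖ ≤ 1 := norm_one_add_mul_le ha (norm_one_add_genDev_le ha K _)
    have h2 : ‖(a : ℂ) * v‖ ≤ ‖v‖ := by
      rw [norm_mul, Complex.norm_real, Real.norm_of_nonneg ha.1]
      exact mul_le_of_le_one_left (norm_nonneg _) ha.2
    calc _ ≤ ‖Complex.exp (c 0 * Complex.I) - 1‖ * ‖1 + a * v‖ + ‖(a : ℂ) * v‖ := by
          rw [← norm_mul]; exact norm_add_le _ _
      _ ≤ |c 0| * 1 + ‖v‖ := by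
          gcongr
          exact norm_exp_mul_I_sub_one_le _
      _ ≤ _ := by linarith [ih fun k => c (k + 1)]

/-- For `a` near `1` the recursion is nearly additive. Replacing `a v` by `v` costs `(1 - a) ‖v‖`
per step, whence the factor `K (1 - a)`; the products of increments give the square. -/
lemma norm_genDev_sub_le {a : ℝ} (ha : a ∈ Set.Icc (0 : ℝ) 1) (K : ℕ) (c : ℕ → ℝ) :
    ‖genDev a K c - (∑ k ∈ Finset.range K, c k : ℝ) * Complex.I‖
      ≤ (∑ k ∈ Finset.range K, |c k|) ^ 2 + K * (1 - a) * ∑ k ∈ Finset.range K, |c k| := by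
  induction K generalizing c with
  | zero => simp [genDev]
  | succ K ih =>
    have ih' := ih fun k => c (k + 1)
    have hv := norm_genDev_le ha K fun k => c (k + 1)
    rw [genDev, Finset.sum_range_succ', Finset.sum_range_succ']
    set v := genDev a K fun k => c (k + 1)
    set S := ∑ k ∈ Finset.range K, |c (k + 1)|
    set s := ∑ k ∈ Finset.range K, c (k + 1)
    have hS : 0 ≤ S := Finset.sum_nonneg fun _ _ => abs_nonneg _
    have h1a : 0 ≤ 1 - a := sub_nonneg.2 ha.2
    have hav : ‖(a : ℂ) * v‖ ≤ S := by
      rw [norm_mul, Complex.norm_real, Real.norm_of_nonneg ha.1]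
      exact (mul_le_of_le_one_left (norm_nonneg _) ha.2).trans hv
    have h1v : ‖((1 - a : ℝ) : ℂ) * v‖ ≤ (1 - a) * S := by
      rw [norm_mul, Complex.norm_real, Real.norm_of_nonneg h1a]
      gcongr
    have heq : (Complex.exp (c 0 * Complex.I) - 1) * (1 + a * v) + a * v
        - ((s + c 0 : ℝ) : ℂ) * Complex.I
        = (Complex.exp (c 0 * Complex.I) - 1 - c 0 * Complex.I)
          + (Complex.exp (c 0 * Complex.I) - 1) * (a * v) + (v - s * Complex.I)
          - ((1 - a : ℝ) : ℂ) * v := by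
      push_cast; ring
    rw [heq]
    calc _ ≤ ‖Complex.exp (c 0 * Complex.I) - 1 - c 0 * Complex.I‖
          + ‖Complex.exp (c 0 * Complex.I) - 1‖ * ‖(a : ℂ) * v‖ + ‖v - s * Complex.I‖
          + ‖((1 - a : ℝ) : ℂ) * v‖ := by
          refine (norm_sub_le _ _).trans ?_
          gcongr
          refine norm_add₃_le.trans ?_
          rw [norm_mul]
      _ ≤ (c 0) ^ 2 + |c 0| * S + (S ^ 2 + K * (1 - a) * S) + (1 - a) * S := by
          gcongr
          · exact norm_exp_mul_I_sub_one_sub_le _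
          · exact norm_exp_mul_I_sub_one_le _
      _ ≤ _ := by
          rw [← sq_abs (c 0)]
          have h0 := abs_nonneg (c 0)
          have h3 : 0 ≤ |c 0| * S := by positivity
          have h4 : 0 ≤ ((K : ℝ) + 1) * (1 - a) * |c 0| := by positivity
          push_cast
          nlinarith

/-- A bound uniform in `a`, used for domination in the integral over `α`. -/
lemma norm_centredExponent_le {a : ℝ} (ha : a ∈ Set.Icc (0 : ℝ) 1) (K : ℕ) (c : ℕ → ℝ) :
    ‖centredExponent a K c‖ ≤ (∑ k ∈ Finset.range K, |c k|) ^ 2 := by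
  induction K generalizing c with
  | zero => simp [centredExponent]
  | succ K ih =>
    have ih' := ih fun k => c (k + 1)
    have hv := norm_genDev_le ha K fun k => c (k + 1)
    rw [centredExponent, Finset.sum_range_succ']
    set v := genDev a K fun k => c (k + 1)
    set q := centredExponent a K fun k => c (k + 1)
    set S := ∑ k ∈ Finset.range K, |c (k + 1)|
    have hS : 0 ≤ S := Finset.sum_nonneg fun _ _ => abs_nonneg _
    have hav : ‖(a : ℂ) * v‖ ≤ S := by
      rw [norm_mul, Complex.norm_real, Real.norm_of_nonneg ha.1]
      exact (mul_le_of_le_one_left (norm_nonneg _) ha.2).trans hv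
    have heq : (Complex.exp (c 0 * Complex.I) - 1) * (1 + a * v) - c 0 * Complex.I + q
        = (Complex.exp (c 0 * Complex.I) - 1 - c 0 * Complex.I)
          + (Complex.exp (c 0 * Complex.I) - 1) * (a * v) + q := by ring
    rw [heq]
    calc _ ≤ ‖Complex.exp (c 0 * Complex.I) - 1 - c 0 * Complex.I‖
          + ‖Complex.exp (c 0 * Complex.I) - 1‖ * ‖(a : ℂ) * v‖ + ‖q‖ := by
          refine norm_add₃_le.trans ?_
          rw [norm_mul]
      _ ≤ (c 0) ^ 2 + |c 0| * S + S ^ 2 := by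
          gcongr
          · exact norm_exp_mul_I_sub_one_sub_le _
          · exact norm_exp_mul_I_sub_one_le _
      _ ≤ _ := by
          rw [← sq_abs (c 0)]
          nlinarith [abs_nonneg (c 0), mul_nonneg (abs_nonneg (c 0)) hS]

/-- To second order a step adds `-c 0 ^ 2 / 2 + (i c 0) v` with `v ≈ i s`, where `s` is the sum of
the later coefficients. This is `-c 0 ^ 2 / 2 - c 0 s`, the increment of minus half the squared sum.
-/
lemma norm_centredExponent_add_le {a : ℝ} (ha : a ∈ Set.Icc (0 : ℝ) 1) (K : ℕ) (c : ℕ → ℝ) :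
    ‖centredExponent a K c + ((∑ k ∈ Finset.range K, c k) ^ 2 / 2 : ℝ)‖
      ≤ (∑ k ∈ Finset.range K, |c k|) ^ 3
        + K * (1 - a) * (∑ k ∈ Finset.range K, |c k|) ^ 2 := by
  induction K generalizing c with
  | zero => simp [centredExponent]
  | succ K ih =>
    have ih' := ih fun k => c (k + 1)
    have hv := norm_genDev_le ha K fun k => c (k + 1)
    have hw := norm_genDev_sub_le ha K fun k => c (k + 1)
    rw [centredExponent, Finset.sum_range_succ', Finset.sum_range_succ']
    set v := genDev a K fun k => c (k + 1)
    set q := centredExponent a K fun k => c (k + 1)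
    set S := ∑ k ∈ Finset.range K, |c (k + 1)|
    set s := ∑ k ∈ Finset.range K, c (k + 1)
    have hS : 0 ≤ S := Finset.sum_nonneg fun _ _ => abs_nonneg _
    have h1a : 0 ≤ 1 - a := sub_nonneg.2 ha.2
    have hav : ‖(a : ℂ) * v‖ ≤ S := by
      rw [norm_mul, Complex.norm_real, Real.norm_of_nonneg ha.1]
      exact (mul_le_of_le_one_left (norm_nonneg _) ha.2).trans hv
    have h1v : ‖((1 - a : ℝ) : ℂ) * v‖ ≤ (1 - a) * S := by
      rw [norm_mul, Complex.norm_real, Real.norm_of_nonneg h1a]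
      gcongr
    have heq : (Complex.exp (c 0 * Complex.I) - 1) * (1 + a * v) - c 0 * Complex.I + q
          + (((s + c 0) ^ 2 / 2 : ℝ) : ℂ)
        = (Complex.exp (c 0 * Complex.I) - 1 - c 0 * Complex.I + c 0 ^ 2 / 2)
          + (Complex.exp (c 0 * Complex.I) - 1 - c 0 * Complex.I) * (a * v)
          + (c 0 * Complex.I) * ((v - s * Complex.I) - ((1 - a : ℝ) : ℂ) * v)
          + (q + ((s ^ 2 / 2 : ℝ) : ℂ)) := by
      push_cast
      linear_combination ((s : ℂ) * c 0) * Complex.I_sq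
    rw [heq]
    calc _ ≤ ‖Complex.exp (c 0 * Complex.I) - 1 - c 0 * Complex.I + c 0 ^ 2 / 2‖
          + ‖Complex.exp (c 0 * Complex.I) - 1 - c 0 * Complex.I‖ * ‖(a : ℂ) * v‖
          + |c 0| * (‖v - s * Complex.I‖ + ‖((1 - a : ℝ) : ℂ) * v‖)
          + ‖q + ((s ^ 2 / 2 : ℝ) : ℂ)‖ := by
          refine (norm_add_le _ _).trans ?_
          gcongr
          refine norm_add₃_le.trans ?_
          rw [norm_mul, norm_mul (c 0 * Complex.I), norm_mul (c 0 : ℂ), Complex.norm_I, mul_one,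
            Complex.norm_real, Real.norm_eq_abs]
          gcongr
          exact norm_sub_le _ _
      _ ≤ |c 0| ^ 3 + (c 0) ^ 2 * S + |c 0| * ((S ^ 2 + K * (1 - a) * S) + (1 - a) * S)
          + (S ^ 3 + K * (1 - a) * S ^ 2) := by
          gcongr
          · exact norm_exp_mul_I_sub_one_sub_add_le _
          · exact norm_exp_mul_I_sub_one_sub_le _
      _ ≤ _ := by
          rw [← sq_abs (c 0)]
          set x := |c 0|
          have h0 : 0 ≤ x := abs_nonneg (c 0)
          have e1 : (0 : ℝ) ≤ x ^ 2 * S := by positivity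
          have e2 : (0 : ℝ) ≤ x * S ^ 2 := by positivity
          have e3 : (0 : ℝ) ≤ ((K : ℝ) + 1) * (1 - a) * (x * S) := by positivity
          have e4 : (0 : ℝ) ≤ ((K : ℝ) + 1) * (1 - a) * x ^ 2 := by positivity
          have e5 : (0 : ℝ) ≤ (1 - a) * S ^ 2 := by positivity
          push_cast
          nlinarith

/-! ### Disintegration with respect to the random thinning parameter -/

lemma measurable_driverLaw (lam : ℝ) (i : DriverIndex) :
    Measurable fun a => driverLaw lam a i := by
  refine Measure.measurable_of_measurable_coe _ fun A _ => ?_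
  suffices h : ∀ n, Measurable fun a => driverLaw lam a i {n} by
    have : ∀ a, driverLaw lam a i A = ∑' n, A.indicator (fun n => driverLaw lam a i {n}) n :=
      fun a => (Measure.tsum_indicator_apply_singleton _ _ A.to_countable.measurableSet).symm
    simp_rw [this]
    refine Measurable.tsum fun n => ?_
    by_cases hn : n ∈ A
    · simpa [hn] using h n
    · simp [hn]
  intro n
  cases i with
  | init =>
    simp only [driverLaw, poissonMeasure_singleton]
    fun_prop
  | bernoulli k j =>
    simp only [driverLaw, bernoulliMeasure_def, Measure.add_apply, Measure.smul_apply]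
    have : Measurable fun a : ℝ => Set.projIcc (0 : ℝ) 1 zero_le_one a :=
      continuous_projIcc.measurable
    have h1 : Measurable fun a : ℝ =>
        (unitInterval.toNNReal (Set.projIcc (0 : ℝ) 1 zero_le_one a)) :=
      unitInterval.toNNReal_continuous.measurable.comp this
    have h2 : Measurable fun a : ℝ =>
        (unitInterval.toNNReal (unitInterval.symm (Set.projIcc (0 : ℝ) 1 zero_le_one a))) :=
      (unitInterval.toNNReal_continuous.comp unitInterval.continuous_symm).measurable.comp this
    exact (h1.coe_nnreal_ennreal.mul_const _).add (h2.coe_nnreal_ennreal.mul_const _)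
  | innovation k => exact measurable_const

lemma measurable_driversLaw (lam : ℝ) : Measurable (driversLaw lam) := by
  refine Measurable.measure_of_isPiSystem_of_isProbabilityMeasure
    generateFrom_squareCylinders.symm
    (isPiSystem_squareCylinders (fun _ => MeasurableSpace.isPiSystem_measurableSet) (by simp)) ?_
  rintro _ ⟨s, t, ht, rfl⟩
  have ht' : ∀ i, MeasurableSet (t i) := fun i => ht i trivial
  simp_rw [Measure.infinitePi_pi _ (fun i _ => ht' i)]
  exact Finset.measurable_fun_prod _ fun i _ =>
    (Measure.measurable_coe (ht' i)).comp (measurable_driverLaw lam i)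

/-- The conditional law of the driving variables given the thinning parameter. -/
def driversKernel (lam : ℝ) : Kernel ℝ (DriverIndex → ℕ) where
  toFun := driversLaw lam
  measurable' := measurable_driversLaw lam

instance (lam : ℝ) : IsMarkovKernel (driversKernel lam) :=
  ⟨fun a => inferInstanceAs (IsProbabilityMeasure (driversLaw lam a))⟩

section

variable {Ω₀ : Type*} [MeasurableSpace Ω₀] {P₀ : Measure Ω₀}
  {lam : ℝ} {α₀ : Ω₀ → ℝ} {ξ : ℕ → ℕ → Ω₀ → ℕ} {ε : ℕ → Ω₀ → ℕ} {X₀ : ℕ → Ω₀ → ℕ}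

lemma IsRandomizedINAR1.measurable_drivers (h : IsRandomizedINAR1 P₀ lam α₀ ξ ε X₀)
    (i : DriverIndex) : Measurable (drivers (X₀ 0) ξ ε i) := by
  cases i
  · exact h.measurable_init
  · exact h.measurable_bernoulli _ _
  · exact h.measurable_innovation _

lemma IsRandomizedINAR1.eq_inarPath (h : IsRandomizedINAR1 P₀ lam α₀ ξ ε X₀) (k : ℕ) (ω : Ω₀) :
    X₀ k ω = inarPath (fun i => drivers (X₀ 0) ξ ε i ω) k := by
  induction k with
  | zero => rfl
  | succ k ih => rw [h.recursion, inarPath, ← ih]; rfl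

variable [IsProbabilityMeasure P₀]

lemma setIntegral_condExp_preimage {α : Ω₀ → ℝ} (hα : Measurable α) {A : Set Ω₀}
    (hA : MeasurableSet A) {B : Set ℝ} (hB : MeasurableSet B) :
    ∫ ω in α ⁻¹' B, (P₀⟦A | MeasurableSpace.comap α inferInstance⟧) ω ∂P₀
      = P₀.real (A ∩ α ⁻¹' B) := by
  rw [setIntegral_condExp hα.comap_le ((integrable_const 1).indicator hA) ⟨B, hB, rfl⟩,
    setIntegral_indicator hA, setIntegral_const, Set.inter_comm]
  simp

lemma IsRandomizedINAR1.condProb_singleton (h : IsRandomizedINAR1 P₀ lam α₀ ξ ε X₀)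
    (hlam : 0 ≤ lam) (hα : ∀ᵐ ω ∂P₀, α₀ ω ∈ Set.Ioo (0 : ℝ) 1) (i : DriverIndex) (n : ℕ) :
    P₀⟦drivers (X₀ 0) ξ ε i ⁻¹' {n} | MeasurableSpace.comap α₀ inferInstance⟧
      =ᵐ[P₀] fun ω => (driverLaw lam (α₀ ω) i).real {n} := by
  cases i with
  | init =>
    filter_upwards [h.init_law n, hα] with ω h1 h2
    refine h1.trans ?_
    have : 0 < 1 - α₀ ω := by linarith [h2.2]
    rw [driverLaw, poissonMeasure_real_singleton, Real.coe_toNNReal _ (by positivity)]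
    ring
  | innovation k =>
    filter_upwards [h.innovation_law k n] with ω h1
    refine h1.trans ?_
    rw [driverLaw, poissonMeasure_real_singleton, Real.coe_toNNReal _ hlam]
    ring
  | bernoulli k j =>
    have h0 := h.bernoulli_zero k j
    have h1 := h.bernoulli_one k j
    obtain rfl | rfl | hn : n = 0 ∨ n = 1 ∨ 2 ≤ n := by omega
    · filter_upwards [h0, hα] with ω h2 h3
      refine h2.trans ?_
      rw [driverLaw, bernoulliMeasure_real_apply_of_notMem_of_mem _ (by measurability) (by simp)
        (by simp), Set.projIcc_of_mem _ ⟨h3.1.le, h3.2.le⟩]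
    · filter_upwards [h1, hα] with ω h2 h3
      refine h2.trans ?_
      rw [driverLaw, bernoulliMeasure_real_apply_of_mem_of_notMem _ (by measurability) (by simp)
        (by simp), Set.projIcc_of_mem _ ⟨h3.1.le, h3.2.le⟩]
    -- Only the conditional probabilities of `0` and `1` are prescribed. They add up to one, so the
    -- values `n ≥ 2` form a null event.
    · have hm := h.measurable_bernoulli k j
      have hint : Integrable α₀ P₀ := Integrable.of_bound (C := 1)
        h.measurable_param.aestronglyMeasurable (by
          filter_upwards [hα] with ω hω
          rw [Real.norm_of_nonneg hω.1.le]; exact hω.2.le)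
      have e0 : P₀.real (ξ k j ⁻¹' {0}) = ∫ ω, (1 - α₀ ω) ∂P₀ := by
        have := setIntegral_condExp_preimage (P₀ := P₀) h.measurable_param
          (hm (measurableSet_singleton 0)) MeasurableSet.univ
        simp only [Set.preimage_univ, Set.inter_univ, Measure.restrict_univ] at this
        rw [← this, integral_congr_ae h0]
      have e1 : P₀.real (ξ k j ⁻¹' {1}) = ∫ ω, α₀ ω ∂P₀ := by
        have := setIntegral_condExp_preimage (P₀ := P₀) h.measurable_param
          (hm (measurableSet_singleton 1)) MeasurableSet.univ
        simp only [Set.preimage_univ, Set.inter_univ, Measure.restrict_univ] at this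
        rw [← this, integral_congr_ae h1]
      have e01 : P₀.real (ξ k j ⁻¹' {0} ∪ ξ k j ⁻¹' {1}) = 1 := by
        rw [measureReal_union (Disjoint.preimage _ (by simp)) (hm (measurableSet_singleton 1)),
          e0, e1, integral_sub (integrable_const 1) hint]
        simp
      have e2 : P₀ (ξ k j ⁻¹' {n}) = 0 := by
        have hc := prob_compl_eq_zero_iff (μ := P₀)
          ((hm (measurableSet_singleton 0)).union (hm (measurableSet_singleton 1)))
        refine measure_mono_null ?_ (hc.2 ?_)
        · intro ω hω
          simp only [Set.mem_preimage, Set.mem_singleton_iff] at hω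
          simp only [Set.mem_compl_iff, Set.mem_union, Set.mem_preimage, Set.mem_singleton_iff, hω]
          omega
        · rw [← ENNReal.ofReal_one, ← e01, ofReal_measureReal]
      have e3 : (ξ k j ⁻¹' {n}).indicator (fun _ => (1 : ℝ)) =ᵐ[P₀] 0 :=
        indicator_meas_zero e2
      have e4 := condExp_congr_ae (m := MeasurableSpace.comap α₀ inferInstance) e3
      rw [condExp_zero] at e4
      filter_upwards [e4] with ω h2
      refine h2.trans ?_
      rw [driverLaw, bernoulliMeasure_real_apply_of_notMem_of_notMem _ (by measurability)
        (by simp; omega) (by simp; omega)]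
      rfl

/-- On each event `α₀ ∈ B`, the law of the driver and the mixture of its conditional laws are
measures on the countable space `ℕ`, so agreement on singletons gives agreement on all sets. -/
lemma IsRandomizedINAR1.condProb (h : IsRandomizedINAR1 P₀ lam α₀ ξ ε X₀)
    (hlam : 0 ≤ lam) (hα : ∀ᵐ ω ∂P₀, α₀ ω ∈ Set.Ioo (0 : ℝ) 1) (i : DriverIndex) (A : Set ℕ) :
    P₀⟦drivers (X₀ 0) ξ ε i ⁻¹' A | MeasurableSpace.comap α₀ inferInstance⟧
      =ᵐ[P₀] fun ω => (driverLaw lam (α₀ ω) i).real A := by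
  have hαm := h.measurable_param
  have hd := h.measurable_drivers i
  have hA : MeasurableSet A := A.to_countable.measurableSet
  have hκ : Measurable fun ω => driverLaw lam (α₀ ω) i := (measurable_driverLaw lam i).comp hαm
  have hgm : ∀ A : Set ℕ, Measurable fun a => (driverLaw lam a i).real A := fun A =>
    ((Measure.measurable_coe A.to_countable.measurableSet).comp
      (measurable_driverLaw lam i)).ennreal_toReal
  have hgi : ∀ A : Set ℕ, Integrable (fun ω => (driverLaw lam (α₀ ω) i).real A) P₀ := fun A =>
    Integrable.of_bound (C := 1) ((hgm A).comp hαm).aestronglyMeasurable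
      (ae_of_all _ fun ω => by rw [Real.norm_of_nonneg measureReal_nonneg]; exact measureReal_le_one)
  refine (ae_eq_condExp_of_forall_setIntegral_eq hαm.comap_le
    ((integrable_const 1).indicator (hd hA)) (fun s _ _ => (hgi A).integrableOn) ?_ ?_).symm
  · rintro _ ⟨B, hB, rfl⟩ -
    have key : (P₀.restrict (α₀ ⁻¹' B)).map (drivers (X₀ 0) ξ ε i)
        = (P₀.restrict (α₀ ⁻¹' B)).bind fun ω => driverLaw lam (α₀ ω) i := by
      refine Measure.ext_of_singleton fun n => ?_
      rw [Measure.map_apply hd (measurableSet_singleton n),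
        Measure.bind_apply (measurableSet_singleton n) hκ.aemeasurable,
        Measure.restrict_apply (hd (measurableSet_singleton n))]
      have h1 := setIntegral_condExp_preimage (P₀ := P₀) hαm (hd (measurableSet_singleton n)) hB
      rw [setIntegral_congr_ae (hαm hB)
        ((h.condProb_singleton hlam hα i n).mono fun ω hω _ => hω)] at h1
      rw [← ofReal_measureReal, ← h1, ofReal_integral_eq_lintegral_ofReal (hgi {n}).integrableOn
        (ae_of_all _ fun ω => measureReal_nonneg)]
      simp
    have key' := congrArg (fun m => (m A).toReal) key
    rw [Measure.map_apply hd hA, Measure.bind_apply hA hκ.aemeasurable,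
      Measure.restrict_apply (hd hA)] at key'
    rw [setIntegral_indicator (hd hA), setIntegral_const, Set.inter_comm, smul_eq_mul, mul_one,
      measureReal_def, key', integral_eq_lintegral_of_nonneg_ae
        (ae_of_all _ fun ω => measureReal_nonneg) ((hgm A).comp hαm).aestronglyMeasurable]
    simp
  · exact ((hgm A).comp (comap_measurable α₀)).aestronglyMeasurable

lemma IsRandomizedINAR1.map_drivers (h : IsRandomizedINAR1 P₀ lam α₀ ξ ε X₀)
    (hlam : 0 ≤ lam) (hα : ∀ᵐ ω ∂P₀, α₀ ω ∈ Set.Ioo (0 : ℝ) 1) :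
    P₀.map (fun ω => (α₀ ω, fun i => drivers (X₀ 0) ξ ε i ω))
      = (P₀.map α₀) ⊗ₘ driversKernel lam := by
  have hαm := h.measurable_param
  have hd : Measurable fun ω i => drivers (X₀ 0) ξ ε i ω :=
    measurable_pi_lambda _ h.measurable_drivers
  have hprob := Measure.isProbabilityMeasure_map (μ := P₀) hαm.aemeasurable
  have hprob' := Measure.isProbabilityMeasure_map (μ := P₀) (hαm.prodMk hd).aemeasurable
  refine Measure.ext_prod fun {B C} hB hC => ?_
  have hκ : Measurable fun ω => driversKernel lam (α₀ ω) := (driversKernel lam).measurable.comp hαm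
  -- For fixed `B` both sides are finite measures, so it suffices to compare them on
  -- finite-dimensional boxes, where conditional independence gives the product of the conditional
  -- probabilities.
  have key : (P₀.restrict (α₀ ⁻¹' B)).map (fun ω i => drivers (X₀ 0) ξ ε i ω)
      = (P₀.restrict (α₀ ⁻¹' B)).bind fun ω => driversKernel lam (α₀ ω) := by
    refine ext_of_generate_finite _ generateFrom_squareCylinders.symm
      (isPiSystem_squareCylinders (fun _ => MeasurableSpace.isPiSystem_measurableSet) (by simp))
      ?_ ?_
    · rintro _ ⟨s, t, ht, rfl⟩
      have ht' : ∀ i, MeasurableSet (t i) := fun i => ht i trivial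
      have hbox : MeasurableSet ((s : Set DriverIndex).pi t) :=
        MeasurableSet.pi s.countable_toSet fun i _ => ht' i
      have hpre : (fun ω i => drivers (X₀ 0) ξ ε i ω) ⁻¹' ((s : Set DriverIndex).pi t)
          = ⋂ i ∈ s, drivers (X₀ 0) ξ ε i ⁻¹' t i := by
        ext ω; simp
      rw [Measure.map_apply hd hbox, Measure.bind_apply hbox hκ.aemeasurable,
        Measure.restrict_apply (hd hbox), ← ofReal_measureReal]
      have h1 := setIntegral_condExp_preimage (P₀ := P₀) hαm (hd hbox) hB
      rw [← h1, hpre]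
      have h2 : P₀⟦⋂ i ∈ s, drivers (X₀ 0) ξ ε i ⁻¹' t i | MeasurableSpace.comap α₀ inferInstance⟧
          =ᵐ[P₀] fun ω => (driversKernel lam (α₀ ω)).real ((s : Set DriverIndex).pi t) := by
        refine (h.condIndep s t fun i _ => ht' i).trans ?_
        have h3 : ∀ᵐ ω ∂P₀, ∀ i ∈ s,
            (P₀⟦drivers (X₀ 0) ξ ε i ⁻¹' t i | MeasurableSpace.comap α₀ inferInstance⟧) ω
              = (driverLaw lam (α₀ ω) i).real (t i) :=
          (Finset.eventually_all s).2 fun i _ => h.condProb hlam hα i (t i)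
        filter_upwards [h3] with ω hω
        rw [Finset.prod_apply, Finset.prod_congr rfl hω]
        change _ = (driversLaw lam (α₀ ω)).real _
        rw [measureReal_def, Measure.infinitePi_pi _ fun i _ => ht' i, ENNReal.toReal_prod]
        rfl
      have hgm : Measurable fun ω => (driversKernel lam (α₀ ω)).real ((s : Set DriverIndex).pi t) :=
        ((Measure.measurable_coe hbox).comp hκ).ennreal_toReal
      rw [setIntegral_congr_ae (hαm hB) (h2.mono fun ω hω _ => hω),
        ofReal_integral_eq_lintegral_ofReal _ (ae_of_all _ fun ω => measureReal_nonneg)]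
      · simp
      · exact (Integrable.of_bound (C := 1) hgm.aestronglyMeasurable
          (ae_of_all _ fun ω => by
            rw [Real.norm_of_nonneg measureReal_nonneg]; exact measureReal_le_one)).integrableOn
    · rw [Measure.map_apply hd .univ, Measure.bind_apply .univ hκ.aemeasurable]
      simp
  rw [Measure.map_apply (hαm.prodMk hd) (hB.prod hC), Measure.compProd_apply_prod hB hC,
    setLIntegral_map hB ((driversKernel lam).measurable_coe hC) hαm]
  have h1 := congrArg (fun m => m C) key
  rw [Measure.map_apply hd hC, Measure.restrict_apply (hd hC), Measure.bind_apply hC hκ.aemeasurable] at h1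
  rw [← h1, Set.mk_preimage_prod, Set.inter_comm]

/-- The joint characteristic function of a centred randomized INAR(1) process. -/
lemma IsRandomizedINAR1.integral_exp_sum (h : IsRandomizedINAR1 P₀ lam α₀ ξ ε X₀)
    (hlam : 0 ≤ lam) (hα : ∀ᵐ ω ∂P₀, α₀ ω ∈ Set.Ioo (0 : ℝ) 1) (K : ℕ) (c : ℕ → ℝ) :
    ∫ ω, Complex.exp ((∑ k ∈ Finset.range K, c k * (X₀ k ω - lam / (1 - α₀ ω)) : ℝ)
        * Complex.I) ∂P₀
      = ∫ x, Complex.exp ((lam / (1 - x) : ℝ) * centredExponent x K c) ∂(P₀.map α₀) := by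
  have hαm := h.measurable_param
  have hd : Measurable fun ω i => drivers (X₀ 0) ξ ε i ω :=
    measurable_pi_lambda _ h.measurable_drivers
  have hprob := Measure.isProbabilityMeasure_map (μ := P₀) hαm.aemeasurable
  set F : ℝ × (DriverIndex → ℕ) → ℂ := fun p => Complex.exp
    ((∑ k ∈ Finset.range K, c k * (inarPath p.2 k - lam / (1 - p.1)) : ℝ) * Complex.I) with hF
  have hFm : Measurable F := by
    have : ∀ k, Measurable fun p : ℝ × (DriverIndex → ℕ) => (inarPath p.2 k : ℝ) := fun k =>
      measurable_from_nat.comp ((measurable_inarPath k).comp measurable_snd)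
    fun_prop
  calc _ = ∫ ω, F (α₀ ω, fun i => drivers (X₀ 0) ξ ε i ω) ∂P₀ := by
        simp only [hF, h.eq_inarPath]
    _ = ∫ p, F p ∂((P₀.map α₀) ⊗ₘ driversKernel lam) := by
        rw [← h.map_drivers hlam hα,
          integral_map (hαm.prodMk hd).aemeasurable hFm.aestronglyMeasurable]
    _ = ∫ x, ∫ d, F (x, d) ∂(driversKernel lam x) ∂(P₀.map α₀) := by
        refine Measure.integral_compProd ?_
        exact Integrable.of_bound (C := 1) hFm.aestronglyMeasurable
          (ae_of_all _ fun p => by simp only [hF, Complex.norm_exp_ofReal_mul_I, le_refl])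
    _ = _ := by
        refine integral_congr_ae ?_
        have : ∀ᵐ x ∂(P₀.map α₀), x ∈ Set.Ioo (0 : ℝ) 1 :=
          (ae_map_iff hαm.aemeasurable measurableSet_Ioo).2 hα
        filter_upwards [this] with x hx
        exact integral_exp_sum_centred_inarPath hlam hx K c

end

/-! ### A majorant and the Gamma integral -/

/-- The two bounds have separate roles: after `x = 1 - y / M`, the constant one controls small `y`
and the linear one gives decay `1 / y` for large `y`. -/
lemma norm_one_sub_exp_le {z : ℂ} (hz : ‖Complex.exp z‖ ≤ 1) :
    ‖1 - Complex.exp z‖ ≤ 2 ∧ ‖1 - Complex.exp z‖ ≤ 2 * ‖z‖ := by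
  have h2 : ‖1 - Complex.exp z‖ ≤ 2 := by
    refine (norm_sub_le _ _).trans ?_
    rw [norm_one]
    linarith
  refine ⟨h2, ?_⟩
  rcases le_total ‖z‖ 1 with h | h
  · rw [norm_sub_rev]
    exact Complex.norm_exp_sub_one_le h
  · linarith

/-- An integrable majorant of `y ^ β * min A (B / y)` on `(0, ∞)`, for `-1 < β < 0`. -/
def rpowMajorant (β A B : ℝ) : ℝ → ℝ :=
  (Set.Ioc (0 : ℝ) 1).indicator (fun y => A * y ^ β)
    + (Set.Ioi (1 : ℝ)).indicator (fun y => B * y ^ (β - 1))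

lemma integrable_rpowMajorant {β : ℝ} (hβ : -1 < β) (hβ' : β < 0) (A B : ℝ) :
    Integrable (rpowMajorant β A B) := by
  refine Integrable.add ?_ ?_
  · rw [integrable_indicator_iff measurableSet_Ioc]
    exact (((intervalIntegrable_iff_integrableOn_Ioc_of_le zero_le_one).1
      (intervalIntegral.intervalIntegrable_rpow' hβ)).const_mul A)
  · rw [integrable_indicator_iff measurableSet_Ioi]
    exact (integrableOn_Ioi_rpow_of_lt (by linarith) one_pos).const_mul B

lemma le_rpowMajorant {β A B y r : ℝ} (hy : 0 < y) (hA : r ≤ A) (hB : r ≤ B / y) :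
    y ^ β * r ≤ rpowMajorant β A B y := by
  have hyβ : 0 ≤ y ^ β := (Real.rpow_pos_of_pos hy _).le
  rcases le_or_gt y 1 with h | h
  · have h1 : y ∈ Set.Ioc (0 : ℝ) 1 := ⟨hy, h⟩
    have h2 : y ∉ Set.Ioi (1 : ℝ) := not_lt.2 h
    rw [rpowMajorant, Pi.add_apply, Set.indicator_of_mem h1, Set.indicator_of_notMem h2, add_zero,
      mul_comm]
    gcongr
  · have h1 : y ∉ Set.Ioc (0 : ℝ) 1 := fun h' => h'.2.not_gt h
    rw [rpowMajorant, Pi.add_apply, Set.indicator_of_notMem h1,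
      Set.indicator_of_mem (Set.mem_Ioi.2 h), zero_add]
    calc y ^ β * r ≤ y ^ β * (B / y) := by gcongr
      _ = B * y ^ (β - 1) := by rw [Real.rpow_sub_one hy.ne']; ring

lemma rpowMajorant_nonneg {β A B : ℝ} (hA : 0 ≤ A) (hB : 0 ≤ B) (y : ℝ) :
    0 ≤ rpowMajorant β A B y := by
  refine add_nonneg (Set.indicator_nonneg (fun y hy => ?_) _)
    (Set.indicator_nonneg (fun y hy => ?_) _)
  · exact mul_nonneg hA (Real.rpow_nonneg hy.1.le _)
  · exact mul_nonneg hB (Real.rpow_nonneg (zero_le_one.trans (Set.mem_Ioi.1 hy).le) _)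

lemma one_sub_exp_neg_le (x : ℝ) : 1 - Real.exp (-x) ≤ x := by
  linarith [Real.add_one_le_exp (-x)]

lemma integral_rpow_mul_one_sub_exp_neg_div {β B : ℝ} (hβ : -1 < β) (hβ' : β < 0) (hB : 0 ≤ B) :
    ∫ y in Set.Ioi (0 : ℝ), y ^ β * (1 - Real.exp (-(B / y)))
      = B ^ (1 + β) * (Real.Gamma (-β) / (1 + β)) := by
  -- `B = 0` must be allowed: it occurs when `∑ θ i t i = 0`.
  rcases hB.eq_or_lt with rfl | hB
  · simp [Real.zero_rpow (by linarith : 1 + β ≠ 0)]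
  have h1β : 0 < 1 + β := by linarith
  -- the substitution `z = 1 / y` in Euler's integral
  have hG : ∫ y in Set.Ioi (0 : ℝ), Real.exp (-(B / y)) * y ^ (β - 1)
      = (1 / B) ^ (-β) * Real.Gamma (-β) := by
    rw [← Real.integral_rpow_mul_exp_neg_mul_Ioi (by linarith : 0 < -β) hB,
      ← integral_comp_rpow_Ioi (fun t : ℝ => t ^ (-β - 1) * Real.exp (-(B * t)))
        (by norm_num : (-1 : ℝ) ≠ 0)]
    refine setIntegral_congr_fun measurableSet_Ioi fun y hy => ?_
    have hy : 0 < y := hy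
    simp only [abs_neg, abs_one, one_mul, smul_eq_mul]
    rw [← Real.rpow_mul hy.le, ← mul_assoc, ← Real.rpow_add hy, Real.rpow_neg_one,
      mul_comm, div_eq_mul_inv]
    ring_nf
  have hGpos : 0 < (1 / B) ^ (-β) * Real.Gamma (-β) :=
    mul_pos (by positivity) (Real.Gamma_pos_of_pos (by linarith))
  -- The integral of a non-integrable function is `0` by convention, so the positive value just
  -- computed proves integrability.
  have hGi : IntegrableOn (fun y : ℝ => Real.exp (-(B / y)) * y ^ (β - 1)) (Set.Ioi 0) :=
    Integrable.of_integral_ne_zero (by rw [hG]; exact hGpos.ne')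
  have hi : IntegrableOn (fun y : ℝ => (1 - Real.exp (-(B / y))) * y ^ β) (Set.Ioi 0) := by
    refine Integrable.mono' (integrable_rpowMajorant hβ hβ' 1 B).integrableOn ?_ ?_
    · exact (by fun_prop : Measurable
        fun y : ℝ => (1 - Real.exp (-(B / y))) * y ^ β).aestronglyMeasurable
    · refine (ae_restrict_iff' measurableSet_Ioi).2 (ae_of_all _ fun y hy => ?_)
      have hy : 0 < y := hy
      have h0 : Real.exp (-(B / y)) ≤ 1 := Real.exp_le_one_iff.2 (by
        have : 0 < B / y := by positivity
        linarith)
      rw [Real.norm_of_nonneg (mul_nonneg (by linarith) (Real.rpow_nonneg hy.le _)), mul_comm]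
      exact le_rpowMajorant hy (by linarith [Real.exp_pos (-(B / y))]) (one_sub_exp_neg_le _)
  -- Integration by parts. The boundary terms vanish because the product is at most `y ^ (1 + β) /
  -- (1 + β)`, which tends to `0` at `0`, and at most a multiple of `y ^ β`, which tends to `0` at
  -- infinity.
  have hparts := integral_Ioi_mul_deriv_eq_deriv_mul (a := 0) (a' := 0) (b' := 0)
    (u := fun y : ℝ => 1 - Real.exp (-(B / y)))
    (u' := fun y : ℝ => -(Real.exp (-(B / y)) * (B / y ^ 2)))
    (v := fun y : ℝ => y ^ (1 + β) / (1 + β)) (v' := fun y : ℝ => y ^ β)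
    (fun y hy => by
      have hy : y ≠ 0 := ne_of_gt hy
      have h1 : HasDerivAt (fun y : ℝ => -(B / y)) (B / y ^ 2) y := by
        have := ((hasDerivAt_inv hy).const_mul B).neg
        simp only [div_eq_mul_inv]
        exact this.congr_deriv (by ring)
      exact (h1.exp.const_sub 1))
    (fun y hy => by
      have hy : y ≠ 0 := ne_of_gt hy
      refine ((Real.hasDerivAt_rpow_const (p := 1 + β) (Or.inl hy)).div_const (1 + β)).congr_deriv ?_
      rw [show 1 + β - 1 = β by ring]
      field_simp)
    hi
    (by
      refine IntegrableOn.congr_fun (Integrable.const_mul hGi (-(B / (1 + β)))) (fun y hy => ?_) measurableSet_Ioi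
      have hy : 0 < y := hy
      simp only [Pi.mul_apply]
      rw [show β - 1 = (1 + β) - 2 by ring, Real.rpow_sub hy, Real.rpow_two]
      field_simp)
    (by
      have h1 : Tendsto (fun y : ℝ => y ^ (1 + β) / (1 + β)) (𝓝[>] 0) (𝓝 0) := by
        have := ((Real.continuousAt_rpow_const 0 (1 + β) (Or.inr h1β.le)).tendsto.div_const
          (1 + β)).mono_left (nhdsWithin_le_nhds (s := Set.Ioi 0))
        simpa [Real.zero_rpow h1β.ne'] using this
      refine squeeze_zero_norm' ?_ h1
      filter_upwards [self_mem_nhdsWithin] with y hy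
      have hy : 0 < y := hy
      have h0 : Real.exp (-(B / y)) ≤ 1 := Real.exp_le_one_iff.2 (by
        have : 0 < B / y := by positivity
        linarith)
      have h2 : 0 ≤ y ^ (1 + β) / (1 + β) := by positivity
      simp only [Pi.mul_apply]
      rw [Real.norm_of_nonneg (mul_nonneg (by linarith) h2)]
      exact mul_le_of_le_one_left h2 (by linarith [Real.exp_pos (-(B / y))]))
    (by
      have h1 : Tendsto (fun y : ℝ => B / (1 + β) * y ^ β) atTop (𝓝 0) := by
        have := (tendsto_rpow_neg_atTop (by linarith : 0 < -β)).const_mul (B / (1 + β))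
        simpa using this
      refine squeeze_zero_norm' ?_ h1
      filter_upwards [eventually_gt_atTop 0] with y hy
      have h0 : Real.exp (-(B / y)) ≤ 1 := Real.exp_le_one_iff.2 (by
        have : 0 < B / y := by positivity
        linarith)
      have h2 : 0 ≤ y ^ (1 + β) / (1 + β) := by positivity
      simp only [Pi.mul_apply]
      rw [Real.norm_of_nonneg (mul_nonneg (by linarith) h2)]
      calc _ ≤ B / y * (y ^ (1 + β) / (1 + β)) := by
            gcongr
            exact one_sub_exp_neg_le _
        _ = _ := by
            rw [Real.rpow_add hy, Real.rpow_one]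
            field_simp)
  calc ∫ y in Set.Ioi (0 : ℝ), y ^ β * (1 - Real.exp (-(B / y)))
      = ∫ y in Set.Ioi (0 : ℝ), (1 - Real.exp (-(B / y))) * y ^ β := by
        simp_rw [mul_comm]
    _ = B / (1 + β) * ∫ y in Set.Ioi (0 : ℝ), Real.exp (-(B / y)) * y ^ (β - 1) := by
        rw [hparts, sub_zero, zero_sub, ← integral_neg, ← integral_const_mul]
        refine setIntegral_congr_fun measurableSet_Ioi fun y hy => ?_
        have hy : 0 < y := hy
        rw [show β - 1 = (1 + β) - 2 by ring, Real.rpow_sub hy, Real.rpow_two]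
        field_simp
    _ = _ := by
        rw [hG, Real.rpow_neg (by positivity), one_div, Real.inv_rpow hB.le, inv_inv,
          Real.rpow_add hB, Real.rpow_one]
        ring

/-! ### Asymptotics of integrals against the mixing law -/

section mixing

variable {β : ℝ} {ψ : ℝ → ℝ}

lemma aemeasurable_mixingDensity
    (hψ_meas : AEMeasurable ψ (volume.restrict (Set.Ioo (0 : ℝ) 1))) :
    AEMeasurable (fun x => ψ x * (1 - x) ^ β) (volume.restrict (Set.Ioo (0 : ℝ) 1)) :=
  hψ_meas.mul (by fun_prop : Measurable fun x : ℝ => (1 - x) ^ β).aemeasurable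

lemma mixingDensity_nonneg (hψ_nonneg : ∀ x ∈ Set.Ioo (0 : ℝ) 1, 0 ≤ ψ x) {x : ℝ}
    (hx : x ∈ Set.Ioo (0 : ℝ) 1) : 0 ≤ ψ x * (1 - x) ^ β :=
  mul_nonneg (hψ_nonneg x hx) (Real.rpow_nonneg (by linarith [hx.2]) _)

lemma integral_mixingLaw (hψ_meas : AEMeasurable ψ (volume.restrict (Set.Ioo (0 : ℝ) 1)))
    (hψ_nonneg : ∀ x ∈ Set.Ioo (0 : ℝ) 1, 0 ≤ ψ x) (f : ℝ → ℂ) :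
    ∫ x, f x ∂(mixingLaw ψ β)
      = ∫ x, (Set.Ioo (0 : ℝ) 1).indicator (fun x => (ψ x * (1 - x) ^ β) • f x) x := by
  rw [mixingLaw, integral_withDensity_eq_integral_toReal_smul₀
    (aemeasurable_mixingDensity hψ_meas).ennreal_ofReal (ae_of_all _ fun _ => ENNReal.ofReal_lt_top),
    integral_indicator measurableSet_Ioo]
  refine setIntegral_congr_fun measurableSet_Ioo fun x hx => ?_
  rw [ENNReal.toReal_ofReal (mixingDensity_nonneg hψ_nonneg hx)]

lemma integrable_mixingLaw_iff
    (hψ_meas : AEMeasurable ψ (volume.restrict (Set.Ioo (0 : ℝ) 1)))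
    (hψ_nonneg : ∀ x ∈ Set.Ioo (0 : ℝ) 1, 0 ≤ ψ x) {E : Type*} [NormedAddCommGroup E]
    [NormedSpace ℝ E] (f : ℝ → E) :
    Integrable f (mixingLaw ψ β)
      ↔ Integrable ((Set.Ioo (0 : ℝ) 1).indicator fun x => (ψ x * (1 - x) ^ β) • f x) := by
  rw [mixingLaw, integrable_withDensity_iff_integrable_smul₀'
    (aemeasurable_mixingDensity hψ_meas).ennreal_ofReal (ae_of_all _ fun _ => ENNReal.ofReal_lt_top),
    integrable_indicator_iff measurableSet_Ioo]
  refine integrableOn_congr_fun (fun x hx => ?_) measurableSet_Ioo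
  rw [ENNReal.toReal_ofReal (mixingDensity_nonneg hψ_nonneg hx)]

/-- Here `1 - x ≥ δ`, so the integral is `O(1 / M)` and the scaled one is `O(M ^ β)`, with `β < 0`.
-/
lemma tendsto_rpow_mul_setIntegral_away_from_one
    (hβ' : β < 0)
    (hψ_nonneg : ∀ x ∈ Set.Ioo (0 : ℝ) 1, 0 ≤ ψ x)
    (hw : Integrable ((Set.Ioo (0 : ℝ) 1).indicator fun x => ψ x * (1 - x) ^ β))
    {M : ℕ → ℝ} (hM : Tendsto M atTop atTop) {G : ℕ → ℝ → ℂ} {D δ : ℝ} (hδ : 0 < δ) (hD : 0 ≤ D)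
    (hG : ∀ᶠ n in atTop, ∀ x ∈ Set.Ioo (0 : ℝ) 1, ‖G n x‖ ≤ D / ((1 - x) * M n)) :
    Tendsto (fun n => ((M n) ^ (1 + β) : ℝ) • ∫ x in (Set.Ioi (1 - δ))ᶜ,
      (Set.Ioo (0 : ℝ) 1).indicator (fun x => (ψ x * (1 - x) ^ β) • G n x) x) atTop (𝓝 0) := by
  set w := (Set.Ioo (0 : ℝ) 1).indicator fun x => ψ x * (1 - x) ^ β with hw_def
  have hw0 : ∀ x, 0 ≤ w x := Set.indicator_nonneg fun x hx => mixingDensity_nonneg hψ_nonneg hx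
  have hlim : Tendsto (fun n => D / δ * (∫ x, w x) * (M n) ^ β) atTop (𝓝 0) := by
    have := ((tendsto_rpow_neg_atTop (by linarith : 0 < -β)).comp hM).const_mul
      (D / δ * (∫ x, w x))
    simpa using this
  refine squeeze_zero_norm' ?_ hlim
  filter_upwards [hG, hM.eventually_gt_atTop 0] with n hn hMn
  have hb : ‖∫ x in (Set.Ioi (1 - δ))ᶜ,
      (Set.Ioo (0 : ℝ) 1).indicator (fun x => (ψ x * (1 - x) ^ β) • G n x) x‖
      ≤ D / (δ * M n) * ∫ x, w x := by
    calc _ ≤ ∫ x in (Set.Ioi (1 - δ))ᶜ, D / (δ * M n) * w x := by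
          refine norm_integral_le_of_norm_le (hw.const_mul _).integrableOn ?_
          refine (ae_restrict_iff' measurableSet_Ioi.compl).2 (ae_of_all _ fun x hx => ?_)
          have hx : x ≤ 1 - δ := not_lt.1 hx
          by_cases hx' : x ∈ Set.Ioo (0 : ℝ) 1
          · rw [hw_def, Set.indicator_of_mem hx', Set.indicator_of_mem hx', norm_smul,
              Real.norm_of_nonneg (mixingDensity_nonneg hψ_nonneg hx'), mul_comm]
            refine mul_le_mul_of_nonneg_right ((hn x hx').trans ?_)
              (mixingDensity_nonneg hψ_nonneg hx')
            gcongr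
            linarith
          · rw [hw_def, Set.indicator_of_notMem hx', Set.indicator_of_notMem hx']
            simp
      _ ≤ ∫ x, D / (δ * M n) * w x := by
          refine setIntegral_le_integral (hw.const_mul _) (ae_of_all _ fun x => ?_)
          exact mul_nonneg (by positivity) (hw0 x)
      _ = _ := integral_const_mul _ _
  rw [norm_smul, Real.norm_of_nonneg (by positivity)]
  calc _ ≤ (M n) ^ (1 + β) * (D / (δ * M n) * ∫ x, w x) := by gcongr
    _ = _ := by
      rw [Real.rpow_add hMn, Real.rpow_one]
      field_simp

lemma tendsto_rpow_mul_setIntegral_near_one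
    {ψ₁ : ℝ} (hβ : -1 < β) (hβ' : β < 0)
    (hψ_nonneg : ∀ x ∈ Set.Ioo (0 : ℝ) 1, 0 ≤ ψ x)
    (hψ_lim : Tendsto ψ (𝓝[<] 1) (𝓝 ψ₁))
    {M : ℕ → ℝ} (hM : Tendsto M atTop atTop) {G : ℕ → ℝ → ℂ} {D δ A : ℝ} (hδ : 0 < δ)
    (hδ1 : δ < 1) (hD : 0 ≤ D) (hA : ∀ x ∈ Set.Ioo (1 - δ) 1, ψ x ≤ A)
    (hGi : ∀ n, Integrable ((Set.Ioo (0 : ℝ) 1).indicator fun x => (ψ x * (1 - x) ^ β) • G n x))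
    (hG : ∀ᶠ n in atTop, ∀ x ∈ Set.Ioo (0 : ℝ) 1, ‖G n x‖ ≤ D / ((1 - x) * M n))
    (hG2 : ∀ n, ∀ x ∈ Set.Ioo (0 : ℝ) 1, ‖G n x‖ ≤ 2)
    {H : ℝ → ℂ} (hlim : ∀ y, 0 < y → Tendsto (fun n => G n (1 - y / M n)) atTop (𝓝 (H y))) :
    Tendsto (fun n => ((M n) ^ (1 + β) : ℝ) • ∫ x in Set.Ioi (1 - δ),
      (Set.Ioo (0 : ℝ) 1).indicator (fun x => (ψ x * (1 - x) ^ β) • G n x) x) atTop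
      (𝓝 (∫ y in Set.Ioi (0 : ℝ), (ψ₁ * y ^ β) • H y)) := by
  have hA0 : 0 ≤ A := by
    have h : 1 - δ / 2 ∈ Set.Ioo (1 - δ) 1 := ⟨by linarith, by linarith⟩
    exact (hψ_nonneg _ ⟨by linarith [h.1], h.2⟩).trans (hA _ h)
  set g : ℕ → ℝ → ℂ := fun n => (Set.Ioo (1 - δ) 1).indicator
    fun x => (ψ x * (1 - x) ^ β) • G n x with hg
  have hgeq : ∀ n, (Set.Ioi (1 - δ)).indicator
      ((Set.Ioo (0 : ℝ) 1).indicator fun x => (ψ x * (1 - x) ^ β) • G n x) = g n := by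
    intro n
    rw [Set.indicator_indicator, hg]
    congr 1
    ext x
    simp only [Set.mem_inter_iff, Set.mem_Ioi, Set.mem_Ioo]
    constructor
    · rintro ⟨h1, h2, h3⟩; exact ⟨h1, h3⟩
    · rintro ⟨h1, h2⟩; exact ⟨h1, by linarith, h2⟩
  have hgi : ∀ n, Integrable (g n) := fun n => by
    rw [← hgeq n]; exact (hGi n).indicator measurableSet_Ioi
  -- Substitution `x = 1 - y / M n`: the Jacobian uses up one factor `M n`, and the remaining `M n ^
  -- β` will cancel against `(1 - x) ^ β = y ^ β / M n ^ β`.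
  have hchange : ∀ᶠ n in atTop, ((M n) ^ (1 + β) : ℝ) • ∫ x in Set.Ioi (1 - δ),
      (Set.Ioo (0 : ℝ) 1).indicator (fun x => (ψ x * (1 - x) ^ β) • G n x) x
      = ∫ y, ((M n) ^ β : ℝ) • g n (1 - y / M n) := by
    filter_upwards [hM.eventually_gt_atTop 0] with n hMn
    rw [← integral_indicator measurableSet_Ioi, hgeq n, integral_smul,
      Measure.integral_comp_div (fun y => g n (1 - y)) (M n), integral_sub_left_eq_self (g n),
      smul_smul, abs_of_pos hMn, Real.rpow_add hMn, Real.rpow_one, mul_comm]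
  rw [tendsto_congr' hchange, ← integral_indicator measurableSet_Ioi]
  refine tendsto_integral_filter_of_dominated_convergence (rpowMajorant β (A * 2) (A * D))
    ?_ ?_ (integrable_rpowMajorant hβ hβ' _ _) ?_
  · filter_upwards [hM.eventually_gt_atTop 0] with n hMn
    exact (((hgi n).comp_sub_left 1).comp_div hMn.ne').aestronglyMeasurable.const_smul
      (M n ^ β)
  · filter_upwards [hM.eventually_gt_atTop 0, hG] with n hMn hn
    refine ae_of_all _ fun y => ?_
    by_cases hy : 1 - y / M n ∈ Set.Ioo (1 - δ) 1
    · have hy0 : 0 < y := by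
        have := hy.2
        have : 0 < y / M n := by linarith
        exact (div_pos_iff_of_pos_right hMn).1 this
      have hx : 1 - y / M n ∈ Set.Ioo (0 : ℝ) 1 := ⟨by linarith [hy.1], hy.2⟩
      rw [hg]
      simp only
      rw [Set.indicator_of_mem hy, norm_smul, norm_smul, Real.norm_of_nonneg (by positivity),
        Real.norm_of_nonneg (mixingDensity_nonneg hψ_nonneg hx), sub_sub_cancel,
        Real.div_rpow hy0.le hMn.le]
      have e : (M n) ^ β * (ψ (1 - y / M n) * (y ^ β / (M n) ^ β) * ‖G n (1 - y / M n)‖)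
          = y ^ β * (ψ (1 - y / M n) * ‖G n (1 - y / M n)‖) := by
        have : (M n) ^ β ≠ 0 := (Real.rpow_pos_of_pos hMn _).ne'
        field_simp
      rw [e]
      refine le_rpowMajorant hy0 ?_ ?_
      · exact mul_le_mul (hA _ hy) (hG2 n _ hx) (norm_nonneg _) hA0
      · rw [mul_div_assoc]
        refine mul_le_mul (hA _ hy) ((hn _ hx).trans_eq ?_) (norm_nonneg _) hA0
        rw [sub_sub_cancel, div_mul_cancel₀ _ hMn.ne']
    · rw [hg]
      simp only
      rw [Set.indicator_of_notMem hy, smul_zero, norm_zero]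
      exact rpowMajorant_nonneg (by positivity) (by positivity) y
  · refine ae_of_all _ fun y => ?_
    rcases le_or_gt y 0 with hy | hy
    · rw [Set.indicator_of_notMem (by simpa using hy)]
      refine Tendsto.congr' ?_ tendsto_const_nhds
      filter_upwards [hM.eventually_gt_atTop 0] with n hMn
      rw [hg]
      simp only
      rw [Set.indicator_of_notMem, smul_zero]
      rintro ⟨-, h⟩
      have : 0 < y / M n := by linarith
      exact absurd ((div_pos_iff_of_pos_right hMn).1 this) hy.not_gt
    · rw [Set.indicator_of_mem (Set.mem_Ioi.2 hy)]
      have h0 : Tendsto (fun n => y / M n) atTop (𝓝 0) := hM.const_div_atTop y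
      have h1 : Tendsto (fun n => 1 - y / M n) atTop (𝓝[<] 1) := by
        refine tendsto_nhdsWithin_iff.2 ⟨by simpa using h0.const_sub 1, ?_⟩
        filter_upwards [hM.eventually_gt_atTop 0] with n hMn
        have : 0 < y / M n := by positivity
        simpa using this
      have h2 := (((hψ_lim.comp h1).mul_const (y ^ β))).smul (hlim y hy)
      refine h2.congr' ?_
      filter_upwards [hM.eventually_gt_atTop 0, h0.eventually_lt_const hδ] with n hMn hn
      have hpos : 0 < y / M n := by positivity
      have hmem : 1 - y / M n ∈ Set.Ioo (1 - δ) 1 := ⟨by linarith, by linarith⟩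
      rw [hg]
      simp only [Function.comp]
      rw [Set.indicator_of_mem hmem, smul_smul, sub_sub_cancel, Real.div_rpow hy.le hMn.le]
      congr 1
      have : (M n) ^ β ≠ 0 := (Real.rpow_pos_of_pos hMn _).ne'
      field_simp

/-- The asymptotics of the characteristic function of one copy: if `M n → ∞` and
`M n * Q n (1 - y / M n) → - T ^ 2 / 2`, then `1 - E exp (lam / (1 - α) * Q n α)` is of order
`(M n) ^ (- (1 + β))`. -/
lemma tendsto_rpow_mul_integral_mixingLaw
    {lam ψ₁ : ℝ} (hlam : 0 < lam) (hβ : -1 < β) (hβ' : β < 0)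
    (hψ_meas : AEMeasurable ψ (volume.restrict (Set.Ioo (0 : ℝ) 1)))
    (hψ_nonneg : ∀ x ∈ Set.Ioo (0 : ℝ) 1, 0 ≤ ψ x)
    (hψ_lim : Tendsto ψ (𝓝[<] 1) (𝓝 ψ₁)) [IsProbabilityMeasure (mixingLaw ψ β)]
    {M : ℕ → ℝ} (hM : Tendsto M atTop atTop) {Q : ℕ → ℝ → ℂ} (hQm : ∀ n, Measurable (Q n))
    {C T : ℝ} (hC : 0 ≤ C)
    (hQ : ∀ᶠ n in atTop, ∀ x ∈ Set.Ioo (0 : ℝ) 1, ‖Q n x‖ ≤ C / M n)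
    (hexp : ∀ n, ∀ x ∈ Set.Ioo (0 : ℝ) 1, ‖Complex.exp ((lam / (1 - x) : ℝ) * Q n x)‖ ≤ 1)
    (hlim : ∀ y, 0 < y → Tendsto (fun n => (M n : ℂ) * Q n (1 - y / M n)) atTop
      (𝓝 (-(T ^ 2 / 2 : ℝ)))) :
    Tendsto (fun n => ((M n) ^ (1 + β) : ℝ) •
        ∫ x, (1 - Complex.exp ((lam / (1 - x) : ℝ) * Q n x)) ∂(mixingLaw ψ β)) atTop
      (𝓝 (stableConst ψ₁ lam β * |T| ^ (2 * (1 + β)) : ℝ)) := by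
  set G : ℕ → ℝ → ℂ := fun n x => 1 - Complex.exp ((lam / (1 - x) : ℝ) * Q n x) with hG
  have hGm : ∀ n, Measurable (G n) := fun n => by
    have := hQm n
    fun_prop
  have hsupp : ∀ᵐ x ∂(mixingLaw ψ β), x ∈ Set.Ioo (0 : ℝ) 1 :=
    (withDensity_absolutelyContinuous _ _).ae_le (ae_restrict_mem measurableSet_Ioo)
  have hG2 : ∀ n, ∀ x ∈ Set.Ioo (0 : ℝ) 1, ‖G n x‖ ≤ 2 := fun n x hx =>
    (norm_one_sub_exp_le (hexp n x hx)).1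
  have hGb : ∀ᶠ n in atTop, ∀ x ∈ Set.Ioo (0 : ℝ) 1,
      ‖G n x‖ ≤ (2 * lam * C) / ((1 - x) * M n) := by
    filter_upwards [hQ, hM.eventually_gt_atTop 0] with n hn hMn x hx
    have hx1 : 0 < 1 - x := by linarith [hx.2]
    refine (norm_one_sub_exp_le (hexp n x hx)).2.trans ?_
    rw [norm_mul, Complex.norm_real, Real.norm_of_nonneg (by positivity)]
    calc 2 * (lam / (1 - x) * ‖Q n x‖) ≤ 2 * (lam / (1 - x) * (C / M n)) := by
          gcongr
          exact hn x hx
      _ = _ := by field_simp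
  have hGi : ∀ n, Integrable
      ((Set.Ioo (0 : ℝ) 1).indicator fun x => (ψ x * (1 - x) ^ β) • G n x) := fun n =>
    (integrable_mixingLaw_iff hψ_meas hψ_nonneg (G n)).1
      (Integrable.of_bound (C := 2) (hGm n).aestronglyMeasurable (hsupp.mono (hG2 n)))
  have hw : Integrable ((Set.Ioo (0 : ℝ) 1).indicator fun x => ψ x * (1 - x) ^ β) := by
    simpa using (integrable_mixingLaw_iff (β := β) hψ_meas hψ_nonneg (fun _ => (1 : ℝ))).1
      (integrable_const _)
  -- Only near `1` is `ψ` known to be bounded. This is why the integral is split at `1 - δ`.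
  obtain ⟨δ, hδ, hδ1, hA⟩ : ∃ δ : ℝ, 0 < δ ∧ δ < 1 ∧ ∀ x ∈ Set.Ioo (1 - δ) 1, ψ x ≤ ψ₁ + 1 := by
    have h1 : ∀ᶠ x in 𝓝[<] (1 : ℝ), ψ x < ψ₁ + 1 := hψ_lim.eventually_lt_const (by linarith)
    obtain ⟨l, hl, hl'⟩ := (mem_nhdsLT_iff_exists_Ioo_subset).1 h1
    have hl : l < 1 := hl
    refine ⟨min (1 - l) (1 / 2), lt_min (by linarith) (by norm_num),
      (min_le_right _ _).trans_lt (by norm_num), fun x hx => (hl' ⟨?_, hx.2⟩).le⟩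
    have := hx.1
    have := min_le_left (1 - l) (1 / 2)
    linarith
  set H : ℝ → ℂ := fun y => 1 - Complex.exp ((-(lam * T ^ 2 / 2 / y) : ℝ)) with hH
  have hGlim : ∀ y, 0 < y → Tendsto (fun n => G n (1 - y / M n)) atTop (𝓝 (H y)) := by
    intro y hy
    have h1 := (hlim y hy).const_mul ((lam / y : ℝ) : ℂ)
    have h2 : Tendsto (fun n => ((lam / (1 - (1 - y / M n)) : ℝ) : ℂ) * Q n (1 - y / M n)) atTop
        (𝓝 ((-(lam * T ^ 2 / 2 / y) : ℝ))) := by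
      have e : (((-(lam * T ^ 2 / 2 / y) : ℝ)) : ℂ)
          = ((lam / y : ℝ) : ℂ) * (-(T ^ 2 / 2 : ℝ)) := by
        push_cast; ring
      rw [e]
      refine h1.congr' ?_
      filter_upwards [hM.eventually_gt_atTop 0] with n hMn
      have : (M n : ℂ) ≠ 0 := by exact_mod_cast hMn.ne'
      have : (y : ℂ) ≠ 0 := by exact_mod_cast hy.ne'
      rw [sub_sub_cancel]
      push_cast
      field_simp
    exact (h2.cexp).const_sub 1
  have hnear := tendsto_rpow_mul_setIntegral_near_one hβ hβ' hψ_nonneg hψ_lim hM hδ hδ1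
    (by positivity) hA hGi hGb hG2 hGlim
  have haway := tendsto_rpow_mul_setIntegral_away_from_one hβ' hψ_nonneg hw hM hδ
    (by positivity) hGb
  have hsum := hnear.add haway
  have hval : ∫ y in Set.Ioi (0 : ℝ), (ψ₁ * y ^ β) • H y
      = ((stableConst ψ₁ lam β * |T| ^ (2 * (1 + β)) : ℝ) : ℂ) := by
    have e : ∀ y : ℝ, (ψ₁ * y ^ β) • H y
        = ((ψ₁ * (y ^ β * (1 - Real.exp (-(lam * T ^ 2 / 2 / y)))) : ℝ) : ℂ) := by
      intro y
      simp only [hH, Complex.real_smul]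
      push_cast
      ring
    simp_rw [e]
    rw [integral_complex_ofReal, integral_const_mul,
      integral_rpow_mul_one_sub_exp_neg_div hβ hβ' (by positivity)]
    congr 1
    rw [stableConst, Real.rpow_mul (abs_nonneg T), Real.rpow_two, sq_abs,
      show lam * T ^ 2 / 2 = lam / 2 * T ^ 2 by ring, Real.mul_rpow (by positivity) (sq_nonneg T)]
    ring
  rw [hval, add_zero] at hsum
  refine hsum.congr fun n => ?_
  rw [integral_mixingLaw hψ_meas hψ_nonneg, ← smul_add,
    integral_add_compl measurableSet_Ioi (hGi n)]

end mixing

/-! ### From one copy to `N` copies, coefficients and growth conditions -/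

/-- Since `log (1 + g) - g = O(|g| ^ 2)` and `N |g| ^ 2 = |N g| |g| → 0`, the logarithm may be
replaced by its linear part. -/
lemma tendsto_one_add_pow_exp_of_tendsto_mul {N : ℕ → ℕ} (hN : Tendsto (fun n => (N n : ℝ)) atTop atTop)
    {g : ℕ → ℂ} {t : ℂ} (hg : Tendsto (fun n => (N n : ℂ) * g n) atTop (𝓝 t)) :
    Tendsto (fun n => (1 + g n) ^ N n) atTop (𝓝 (Complex.exp t)) := by
  have hN0 : ∀ᶠ n in atTop, (N n : ℂ) ≠ 0 := by
    filter_upwards [hN.eventually_gt_atTop 0] with n hn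
    exact_mod_cast hn.ne'
  have hinv : Tendsto (fun n => (N n : ℂ)⁻¹) atTop (𝓝 0) := by
    rw [tendsto_zero_iff_norm_tendsto_zero]
    simpa [Function.comp_def] using tendsto_inv_atTop_zero.comp hN
  have hg0 : Tendsto g atTop (𝓝 0) := by
    have h := hinv.mul hg
    rw [zero_mul] at h
    refine h.congr' ?_
    filter_upwards [hN0] with n hn
    rw [inv_mul_cancel_left₀ hn]
  have hsmall : ∀ᶠ n in atTop, ‖g n‖ < 1 / 2 :=
    hg0.norm.eventually_lt_const (by simp)
  have hlog : Tendsto (fun n => (N n : ℂ) * Complex.log (1 + g n)) atTop (𝓝 t) := by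
    have hdiff : Tendsto (fun n => (N n : ℂ) * (Complex.log (1 + g n) - g n)) atTop (𝓝 0) := by
      have hb : Tendsto (fun n => ‖(N n : ℂ) * g n‖ * ‖g n‖) atTop (𝓝 0) := by
        simpa using hg.norm.mul hg0.norm
      refine squeeze_zero_norm' ?_ hb
      filter_upwards [hsmall] with n hn
      have h1 := Complex.norm_log_one_add_sub_self_le (show ‖g n‖ < 1 by linarith)
      have h2 : (1 - ‖g n‖)⁻¹ ≤ 2 := by
        rw [inv_le_comm₀ (by linarith) (by norm_num)]
        linarith
      have h3 : ‖Complex.log (1 + g n) - g n‖ ≤ ‖g n‖ ^ 2 := by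
        refine h1.trans ?_
        nlinarith [sq_nonneg ‖g n‖]
      rw [norm_mul, norm_mul, mul_assoc, ← sq]
      gcongr
    have := hdiff.add hg
    rw [zero_add] at this
    refine this.congr fun n => ?_
    ring
  refine (hlog.cexp).congr' ?_
  filter_upwards [hsmall] with n hn
  rw [Complex.exp_nat_mul, Complex.exp_log]
  intro h
  have : g n = -1 := by linear_combination h
  rw [this] at hn
  norm_num at hn

section coefficients

variable {ι : Type*} [Fintype ι]

/-- The coefficient of `X k` in `r * ∑ i, θ i * ∑ k ∈ Icc 1 (m i), X k`. -/
def partialSumCoeff (r : ℝ) (m : ι → ℕ) (θ : ι → ℝ) (k : ℕ) : ℝ :=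
  r * ∑ i, if k ∈ Finset.Icc 1 (m i) then θ i else 0

/-- The length `1 + ∑ i, m i` covers all the intervals at once and stays of order `n` when `m i = ⌊n
t i⌋`. The extra index `0` has coefficient zero. -/
lemma sum_partialSumCoeff_mul (r : ℝ) (m : ι → ℕ) (θ : ι → ℝ) (f : ℕ → ℝ) :
    ∑ k ∈ Finset.range (1 + ∑ i, m i), partialSumCoeff r m θ k * f k
      = r * ∑ i, θ i * ∑ k ∈ Finset.Icc 1 (m i), f k := by
  simp only [partialSumCoeff, mul_assoc, ← Finset.mul_sum, Finset.sum_mul]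
  rw [Finset.sum_comm]
  congr 1
  refine Finset.sum_congr rfl fun i _ => ?_
  have hsub : Finset.Icc 1 (m i) ⊆ Finset.range (1 + ∑ i, m i) := by
    intro k hk
    have h1 : m i ≤ ∑ i, m i := Finset.single_le_sum (fun _ _ => Nat.zero_le _) (Finset.mem_univ i)
    have h2 := (Finset.mem_Icc.1 hk).2
    rw [Finset.mem_range]
    omega
  simp only [ite_mul, zero_mul]
  rw [Finset.sum_ite_mem, Finset.inter_eq_right.2 hsub, Finset.mul_sum]

lemma sum_partialSumCoeff (r : ℝ) (m : ι → ℕ) (θ : ι → ℝ) :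
    ∑ k ∈ Finset.range (1 + ∑ i, m i), partialSumCoeff r m θ k = r * ∑ i, θ i * m i := by
  simpa using sum_partialSumCoeff_mul r m θ (fun _ => 1)

lemma sum_abs_partialSumCoeff_le (r : ℝ) (m : ι → ℕ) (θ : ι → ℝ) :
    ∑ k ∈ Finset.range (1 + ∑ i, m i), |partialSumCoeff r m θ k|
      ≤ |r| * ∑ i, |θ i| * m i := by
  rw [← sum_partialSumCoeff]
  refine Finset.sum_le_sum fun k _ => ?_
  rw [partialSumCoeff, partialSumCoeff, abs_mul]
  gcongr
  refine (Finset.abs_sum_le_sum_abs _ _).trans (Finset.sum_le_sum fun i _ => ?_)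
  split_ifs <;> simp

lemma measurable_genDev (K : ℕ) (c : ℕ → ℝ) : Measurable fun a => genDev a K c := by
  induction K generalizing c with
  | zero => exact measurable_const
  | succ K ih =>
    have := ih fun k => c (k + 1)
    simp only [genDev]
    fun_prop

lemma measurable_centredExponent (K : ℕ) (c : ℕ → ℝ) :
    Measurable fun a => centredExponent a K c := by
  induction K generalizing c with
  | zero => exact measurable_const
  | succ K ih =>
    have := ih fun k => c (k + 1)
    have := measurable_genDev K fun k => c (k + 1)
    simp only [centredExponent]
    fun_prop

/-- The exponential is a characteristic function, so no estimate of the exponent is needed. -/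
lemma norm_exp_centredExponent_le {lam a : ℝ} (hlam : 0 ≤ lam) (ha : a ∈ Set.Ioo (0 : ℝ) 1)
    (K : ℕ) (c : ℕ → ℝ) :
    ‖Complex.exp ((lam / (1 - a) : ℝ) * centredExponent a K c)‖ ≤ 1 := by
  rw [← integral_exp_sum_centred_inarPath hlam ha]
  refine (norm_integral_le_of_norm_le_const (C := 1) (ae_of_all _ fun d => ?_)).trans (by simp)
  rw [Complex.norm_exp_ofReal_mul_I]

lemma nnreal_natFloor_le (n : ℕ) (t : ℝ≥0) : (⌊(n : ℝ≥0) * t⌋₊ : ℝ) ≤ n * t := by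
  exact_mod_cast Nat.floor_le (zero_le : 0 ≤ (n : ℝ≥0) * t)

lemma tendsto_inv_mul_natFloor (t : ℝ≥0) :
    Tendsto (fun n : ℕ => (n : ℝ)⁻¹ * (⌊(n : ℝ≥0) * t⌋₊ : ℝ)) atTop (𝓝 t) := by
  have h := (tendsto_nat_floor_mul_div_atTop (R := ℝ) t.coe_nonneg).comp tendsto_natCast_atTop_atTop
  refine h.congr fun n => ?_
  simp only [Function.comp]
  rw [div_eq_inv_mul]
  congr 2
  have : ((t : ℝ) * n) = ((n * t : ℝ≥0) : ℝ) := by push_cast; ring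
  rw [this]
  exact Nonneg.nat_floor_coe _

end coefficients

lemma tendsto_natCast_of_tendsto_rpow_mul_inv {p : ℝ} (hp : 0 < p) {N : ℕ → ℕ}
    (hN : Tendsto (fun n : ℕ => (N n : ℝ) ^ p * (n : ℝ)⁻¹) atTop atTop) :
    Tendsto (fun n => (N n : ℝ)) atTop atTop := by
  rw [tendsto_atTop] at hN ⊢
  intro b
  filter_upwards [hN ((max b 0) ^ p), eventually_ge_atTop 1] with n hn h1
  have h2 : (n : ℝ)⁻¹ ≤ 1 := inv_le_one_of_one_le₀ (by exact_mod_cast h1)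
  have h3 : (max b 0) ^ p ≤ (N n : ℝ) ^ p :=
    hn.trans (mul_le_of_le_one_right (by positivity) h2)
  exact (le_max_left b 0).trans
    ((Real.rpow_le_rpow_iff (le_max_right b 0) (by positivity) hp).1 h3)

/-- Applied with `p = -β / (1 + β)` and `q = 1 / (1 + β)`, it turns the growth assumption into `n /
M → 0`. -/
lemma tendsto_natCast_div_of_tendsto_rpow_mul_inv {p q : ℝ} (hp : 0 < p) (hpq : p ≤ q) {N : ℕ → ℕ}
    (hN : Tendsto (fun n : ℕ => (N n : ℝ) ^ p * (n : ℝ)⁻¹) atTop atTop) :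
    Tendsto (fun n : ℕ => (n : ℝ) / (N n : ℝ) ^ q) atTop (𝓝 0) := by
  refine squeeze_zero' (Eventually.of_forall fun n => by positivity) ?_
    (tendsto_inv_atTop_zero.comp hN)
  filter_upwards [(tendsto_natCast_of_tendsto_rpow_mul_inv hp hN).eventually_ge_atTop 1] with n hn
  simp only [Function.comp, mul_inv, inv_inv]
  rw [div_eq_inv_mul]
  gcongr

section exponent

variable {ι : Type*} [Fintype ι]

lemma sum_abs_partialSumCoeff_natFloor_le {a : ℝ} (ha : 0 ≤ a) (n : ℕ) (t : ι → ℝ≥0)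
    (θ : ι → ℝ) :
    ∑ k ∈ Finset.range (1 + ∑ i, ⌊(n : ℝ≥0) * t i⌋₊),
      |partialSumCoeff ((n : ℝ)⁻¹ * a) (fun i => ⌊(n : ℝ≥0) * t i⌋₊) θ k|
      ≤ a * ∑ i, |θ i| * t i := by
  refine (sum_abs_partialSumCoeff_le _ _ _).trans ?_
  rw [abs_of_nonneg (by positivity), mul_comm _ a, mul_assoc, Finset.mul_sum]
  refine mul_le_mul_of_nonneg_left (Finset.sum_le_sum fun i _ => ?_) ha
  calc (n : ℝ)⁻¹ * (|θ i| * (⌊(n : ℝ≥0) * t i⌋₊ : ℝ)) ≤ (n : ℝ)⁻¹ * (|θ i| * (n * t i)) := by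
        gcongr
        exact nnreal_natFloor_le n (t i)
    _ = ((n : ℝ)⁻¹ * n) * (|θ i| * t i) := by ring
    -- An inequality only because of `n = 0`, where `n⁻¹ * n = 0`.
    _ ≤ 1 * (|θ i| * t i) := by
        gcongr
        exact inv_mul_le_one
    _ = _ := one_mul _

/-- The main term is exact up to the floors, because `a ^ 2 = 1 / M`. As `K = O(n)` and `1 - x = y /
M`, the error after multiplication by `M` is of order `a + 1 / M + n / M`. -/
lemma tendsto_mul_centredExponent {M a : ℕ → ℝ} (hM : Tendsto M atTop atTop)
    (ha : ∀ᶠ n in atTop, 0 ≤ a n ∧ (a n) ^ 2 = (M n)⁻¹)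
    (hnM : Tendsto (fun n : ℕ => (n : ℝ) / M n) atTop (𝓝 0)) (t : ι → ℝ≥0) (θ : ι → ℝ)
    {y : ℝ} (hy : 0 < y) :
    Tendsto (fun n => (M n : ℂ) * centredExponent (1 - y / M n)
      (1 + ∑ i, ⌊(n : ℝ≥0) * t i⌋₊)
      (partialSumCoeff ((n : ℝ)⁻¹ * a n) (fun i => ⌊(n : ℝ≥0) * t i⌋₊) θ)) atTop
      (𝓝 (-((∑ i, θ i * t i) ^ 2 / 2 : ℝ))) := by
  set C := ∑ i, |θ i| * t i
  set K : ℕ → ℕ := fun n => 1 + ∑ i, ⌊(n : ℝ≥0) * t i⌋₊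
  set c : ℕ → ℕ → ℝ := fun n =>
    partialSumCoeff ((n : ℝ)⁻¹ * a n) (fun i => ⌊(n : ℝ≥0) * t i⌋₊) θ
  have hmain : Tendsto (fun n => -((M n) * (∑ k ∈ Finset.range (K n), c n k) ^ 2 / 2)) atTop
      (𝓝 (-((∑ i, θ i * t i) ^ 2 / 2))) := by
    have h1 : Tendsto (fun n : ℕ => ∑ i, θ i * ((n : ℝ)⁻¹ * (⌊(n : ℝ≥0) * t i⌋₊ : ℝ))) atTop
        (𝓝 (∑ i, θ i * t i)) :=
      tendsto_finsetSum _ fun i _ => (tendsto_inv_mul_natFloor (t i)).const_mul (θ i)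
    refine (((h1.pow 2).div_const 2).neg).congr' ?_
    filter_upwards [ha, hM.eventually_gt_atTop 0] with n hn hMn
    simp only [c, K]
    rw [sum_partialSumCoeff, mul_pow, mul_pow, hn.2]
    have : ∑ i, θ i * ((n : ℝ)⁻¹ * (⌊(n : ℝ≥0) * t i⌋₊ : ℝ))
        = (n : ℝ)⁻¹ * ∑ i, θ i * (⌊(n : ℝ≥0) * t i⌋₊ : ℝ) := by
      rw [Finset.mul_sum]
      exact Finset.sum_congr rfl fun i _ => by ring
    rw [this, mul_pow]
    field_simp
  have herr : Tendsto (fun n => (M n : ℂ) * (centredExponent (1 - y / M n) (K n) (c n)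
      + ((∑ k ∈ Finset.range (K n), c n k) ^ 2 / 2 : ℝ))) atTop (𝓝 0) := by
    have hMinv : Tendsto (fun n => (M n)⁻¹) atTop (𝓝 0) := tendsto_inv_atTop_zero.comp hM
    have ha0 : Tendsto a atTop (𝓝 0) := by
      have h := (Real.continuous_sqrt.tendsto 0).comp hMinv
      rw [Real.sqrt_zero] at h
      refine h.congr' ?_
      filter_upwards [ha] with n hn
      rw [Function.comp, ← hn.2, Real.sqrt_sq hn.1]
    have hbound : Tendsto (fun n : ℕ => a n * C ^ 3
        + y * C ^ 2 * ((M n)⁻¹ + (n : ℝ) / M n * ∑ i, (t i : ℝ))) atTop (𝓝 0) := by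
      simpa using (ha0.mul_const (C ^ 3)).add
        ((hMinv.add (hnM.mul_const (∑ i, (t i : ℝ)))).const_mul (y * C ^ 2))
    refine squeeze_zero_norm' ?_ hbound
    filter_upwards [ha, hM.eventually_gt_atTop 0, hM.eventually_gt_atTop y] with n hn hMn hMy
    have hx : 1 - y / M n ∈ Set.Icc (0 : ℝ) 1 := by
      have h1 : y / M n ≤ 1 := (div_le_one hMn).2 hMy.le
      have h2 : 0 ≤ y / M n := by positivity
      exact ⟨by linarith, by linarith⟩
    have hS := sum_abs_partialSumCoeff_natFloor_le hn.1 n t θ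
    have hS0 : 0 ≤ ∑ k ∈ Finset.range (K n), |c n k| := Finset.sum_nonneg fun _ _ => abs_nonneg _
    have hK : (K n : ℝ) ≤ 1 + n * ∑ i, (t i : ℝ) := by
      simp only [K]
      push_cast
      rw [Finset.mul_sum]
      gcongr with i
      exact nnreal_natFloor_le n (t i)
    have hyM : 0 ≤ y / M n := by positivity
    rw [norm_mul, Complex.norm_real, Real.norm_of_nonneg hMn.le]
    calc _ ≤ M n * ((a n * C) ^ 3 + (1 + n * ∑ i, (t i : ℝ)) * (y / M n) * (a n * C) ^ 2) := by
          gcongr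
          refine (norm_centredExponent_add_le hx _ _).trans ?_
          rw [sub_sub_cancel]
          gcongr
      _ = _ := by
          rw [mul_pow, mul_pow, pow_succ (a n) 2, hn.2]
          field_simp
  have hsum := herr.add ((Complex.continuous_ofReal.tendsto _).comp hmain)
  rw [zero_add, Complex.ofReal_neg] at hsum
  refine hsum.congr fun n => ?_
  simp only [Function.comp]
  push_cast
  ring

end exponent

/-! ### Independent copies -/

section copies

variable {Ω₀ Ω : Type*} [MeasurableSpace Ω₀] [MeasurableSpace Ω]
  {P₀ : Measure Ω₀} [IsProbabilityMeasure P₀] {P : Measure Ω} [IsProbabilityMeasure P]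
  {lam : ℝ} {α₀ : Ω₀ → ℝ} {ξ : ℕ → ℕ → Ω₀ → ℕ} {ε : ℕ → Ω₀ → ℕ} {X₀ : ℕ → Ω₀ → ℕ}
  {α : ℕ → Ω → ℝ} {X : ℕ → ℕ → Ω → ℕ} {ι : Type*} [Fintype ι]

omit [IsProbabilityMeasure P₀] [IsProbabilityMeasure P] in
lemma aemeasurable_aggregate
    (hcopy : ∀ j, IdentDistrib (fun ω => (α j ω, fun k => X j k ω))
      (fun ω => (α₀ ω, fun k => X₀ k ω)) P P₀) (N n : ℕ) (t : ℝ≥0) :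
    AEMeasurable (aggregate lam α X N n t) P := by
  unfold aggregate
  refine Finset.aemeasurable_fun_sum _ fun j _ => Finset.aemeasurable_fun_sum _ fun k _ => ?_
  have h := (hcopy j).aemeasurable_fst
  have h1 : AEMeasurable (α j) P := measurable_fst.comp_aemeasurable h
  have h2 : AEMeasurable (fun ω => (X j k ω : ℝ)) P :=
    (measurable_from_nat (f := fun n : ℕ => (n : ℝ))).comp_aemeasurable
      (((measurable_pi_apply k).comp measurable_snd).comp_aemeasurable h)
  fun_prop

-- A linear combination of the values of the aggregate at several times is a sum over copies of one
-- and the same functional, so independence turns its characteristic function into an `N`-th power.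
omit [IsProbabilityMeasure P] in
lemma integral_exp_sum_aggregate (hlam : 0 ≤ lam)
    (hα : ∀ᵐ ω ∂P₀, α₀ ω ∈ Set.Ioo (0 : ℝ) 1)
    (hX₀ : IsRandomizedINAR1 P₀ lam α₀ ξ ε X₀)
    (hcopy : ∀ j, IdentDistrib (fun ω => (α j ω, fun k => X j k ω))
      (fun ω => (α₀ ω, fun k => X₀ k ω)) P P₀)
    (hindep : iIndepFun (fun j ω => (α j ω, fun k => X j k ω)) P)
    (N n : ℕ) (t : ι → ℝ≥0) (θ : ι → ℝ) (r : ℝ) :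
    ∫ ω, Complex.exp ((∑ i, θ i * (r * aggregate lam α X N n (t i) ω) : ℝ) * Complex.I) ∂P
      = (∫ x, Complex.exp ((lam / (1 - x) : ℝ) * centredExponent x
          (1 + ∑ i, ⌊(n : ℝ≥0) * t i⌋₊)
          (partialSumCoeff r (fun i => ⌊(n : ℝ≥0) * t i⌋₊) θ)) ∂(P₀.map α₀)) ^ N := by
  set m : ι → ℕ := fun i => ⌊(n : ℝ≥0) * t i⌋₊
  set K := 1 + ∑ i, m i
  set c := partialSumCoeff r m θ
  set F : ℝ × (ℕ → ℕ) → ℝ := fun p =>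
    ∑ k ∈ Finset.range K, c k * ((p.2 k : ℝ) - lam / (1 - p.1)) with hF
  have hFm : Measurable F := by
    have : ∀ k, Measurable fun p : ℝ × (ℕ → ℕ) => (p.2 k : ℝ) := fun k =>
      measurable_from_nat.comp ((measurable_pi_apply k).comp measurable_snd)
    fun_prop
  set Y : ℕ → Ω → ℝ := fun j ω => F (α j ω, fun k => X j k ω) with hY
  have hsum : ∀ ω, ∑ i, θ i * (r * aggregate lam α X N n (t i) ω)
      = ∑ j ∈ Finset.range N, Y j ω := by
    intro ω
    simp only [hY, hF, c, K]
    simp_rw [sum_partialSumCoeff_mul, ← Finset.mul_sum]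
    rw [Finset.sum_comm, Finset.mul_sum]
    refine Finset.sum_congr rfl fun i _ => ?_
    rw [aggregate, ← Finset.mul_sum]
    ring
  have hYm : ∀ j, AEMeasurable (Y j) P := fun j =>
    hFm.comp_aemeasurable (hcopy j).aemeasurable_fst
  have hYind : iIndepFun Y P := hindep.comp (fun _ => F) fun _ => hFm
  have hYlaw : ∀ j, charFun (P.map (Y j)) 1
      = ∫ ω, Complex.exp ((F (α₀ ω, fun k => X₀ k ω) : ℝ) * Complex.I) ∂P₀ := by
    intro j
    have h := ((hcopy j).comp hFm)
    have h2 := h.map_eq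
    change P.map (Y j) = _ at h2
    rw [h2, charFun_apply_real, integral_map h.aemeasurable_snd (by fun_prop)]
    simp
  have h1 := iIndepFun.charFun_map_fun_finsetSum_eq_prod (s := Finset.range N)
    (fun j _ => hYm j) (hYind.precomp (g := Subtype.val) Subtype.val_injective)
  have h2 := congrFun h1 1
  rw [Finset.prod_apply, Finset.prod_congr rfl fun j _ => hYlaw j, Finset.prod_const,
    Finset.card_range, charFun_apply_real, integral_map
      (Finset.aemeasurable_fun_sum _ fun j _ => hYm j) (by fun_prop)] at h2
  simp_rw [hsum]
  rw [← hX₀.integral_exp_sum hlam hα K c, ← h2]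
  simp

end copies

/-- Convergence of the characteristic functions of the finite-dimensional distributions. -/
lemma tendsto_integral_exp_sum_aggregate
    {Ω₀ Ω : Type*} [MeasurableSpace Ω₀] [MeasurableSpace Ω]
    {P₀ : Measure Ω₀} [IsProbabilityMeasure P₀] {P : Measure Ω} [IsProbabilityMeasure P]
    {lam β ψ₁ : ℝ} (hlam : 0 < lam) (hβ : -1 < β) (hβ' : β < 0)
    {ψ : ℝ → ℝ} (hψ_meas : AEMeasurable ψ (volume.restrict (Set.Ioo (0 : ℝ) 1)))
    (hψ_nonneg : ∀ x ∈ Set.Ioo (0 : ℝ) 1, 0 ≤ ψ x)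
    (hψ_lim : Tendsto ψ (𝓝[<] 1) (𝓝 ψ₁))
    {α₀ : Ω₀ → ℝ} {ξ : ℕ → ℕ → Ω₀ → ℕ} {ε : ℕ → Ω₀ → ℕ} {X₀ : ℕ → Ω₀ → ℕ}
    (hα₀ : P₀.map α₀ = mixingLaw ψ β)
    (hX₀ : IsRandomizedINAR1 P₀ lam α₀ ξ ε X₀)
    {α : ℕ → Ω → ℝ} {X : ℕ → ℕ → Ω → ℕ}
    (hcopy : ∀ j, IdentDistrib (fun ω => (α j ω, fun k => X j k ω))
      (fun ω => (α₀ ω, fun k => X₀ k ω)) P P₀)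
    (hindep : iIndepFun (fun j ω => (α j ω, fun k => X j k ω)) P)
    {N : ℕ → ℕ}
    (hN : Tendsto (fun n : ℕ => (N n : ℝ) ^ (-β / (1 + β)) * (n : ℝ)⁻¹) atTop atTop)
    {ι : Type*} [Fintype ι] (t : ι → ℝ≥0) (θ : ι → ℝ) :
    Tendsto (fun n : ℕ => ∫ ω, Complex.exp ((∑ i, θ i * ((n : ℝ)⁻¹ *
      (N n : ℝ) ^ (-1 / (2 * (1 + β))) * aggregate lam α X (N n) n (t i) ω) : ℝ) * Complex.I) ∂P)
      atTop (𝓝 (Real.exp (-(stableConst ψ₁ lam β * |∑ i, θ i * t i| ^ (2 * (1 + β)))))) := by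
  have h1β : 0 < 1 + β := by linarith
  have hp : 0 < -β / (1 + β) := div_pos (by linarith) h1β
  have hN' := tendsto_natCast_of_tendsto_rpow_mul_inv hp hN
  -- The scales are chosen so that `M ^ (1 + β) = N` and `a ^ 2 = 1 / M`.
  set M : ℕ → ℝ := fun n => (N n : ℝ) ^ (1 / (1 + β)) with hM_def
  set a : ℕ → ℝ := fun n => (N n : ℝ) ^ (-1 / (2 * (1 + β))) with ha_def
  have hM : Tendsto M atTop atTop := (tendsto_rpow_atTop (by positivity)).comp hN'
  have hnM : Tendsto (fun n : ℕ => (n : ℝ) / M n) atTop (𝓝 0) :=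
    tendsto_natCast_div_of_tendsto_rpow_mul_inv hp
      (by gcongr; linarith) hN
  have ha0 : ∀ n, 0 ≤ a n := fun n => by positivity
  have ha : ∀ᶠ n in atTop, 0 ≤ a n ∧ (a n) ^ 2 = (M n)⁻¹ := by
    filter_upwards [hN'.eventually_gt_atTop 0] with n hn
    refine ⟨ha0 n, ?_⟩
    simp only [ha_def, hM_def]
    rw [← Real.rpow_natCast, ← Real.rpow_mul hn.le, ← Real.rpow_neg hn.le]
    congr 1
    push_cast
    field_simp
  have hprob : IsProbabilityMeasure (mixingLaw ψ β) := by
    rw [← hα₀]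
    exact Measure.isProbabilityMeasure_map hX₀.measurable_param.aemeasurable
  have hα : ∀ᵐ ω ∂P₀, α₀ ω ∈ Set.Ioo (0 : ℝ) 1 := by
    refine (ae_map_iff hX₀.measurable_param.aemeasurable measurableSet_Ioo).1 ?_
    rw [hα₀]
    exact (withDensity_absolutelyContinuous _ _).ae_le (ae_restrict_mem measurableSet_Ioo)
  set Q : ℕ → ℝ → ℂ := fun n x => centredExponent x (1 + ∑ i, ⌊(n : ℝ≥0) * t i⌋₊)
    (partialSumCoeff ((n : ℝ)⁻¹ * a n) (fun i => ⌊(n : ℝ≥0) * t i⌋₊) θ) with hQ_def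
  have hQm : ∀ n, Measurable (Q n) := fun n => measurable_centredExponent _ _
  have hQexp : ∀ n, ∀ x ∈ Set.Ioo (0 : ℝ) 1,
      ‖Complex.exp ((lam / (1 - x) : ℝ) * Q n x)‖ ≤ 1 := fun n x hx =>
    norm_exp_centredExponent_le hlam.le hx _ _
  have hQ : ∀ᶠ n in atTop, ∀ x ∈ Set.Ioo (0 : ℝ) 1,
      ‖Q n x‖ ≤ (∑ i, |θ i| * t i) ^ 2 / M n := by
    filter_upwards [ha] with n hn x hx
    refine (norm_centredExponent_le ⟨hx.1.le, hx.2.le⟩ _ _).trans ?_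
    calc _ ≤ (a n * ∑ i, |θ i| * t i) ^ 2 := by
          gcongr
          exact sum_abs_partialSumCoeff_natFloor_le (ha0 n) n t θ
      _ = _ := by rw [mul_pow, hn.2]; ring
  have key := tendsto_rpow_mul_integral_mixingLaw hlam hβ hβ' hψ_meas hψ_nonneg hψ_lim hM hQm
    (by positivity) hQ hQexp (fun y hy => tendsto_mul_centredExponent hM ha hnM t θ hy)
  set z : ℕ → ℂ := fun n => ∫ x, Complex.exp ((lam / (1 - x) : ℝ) * Q n x) ∂(mixingLaw ψ β)
  have hz : ∀ n, ∫ x, (1 - Complex.exp ((lam / (1 - x) : ℝ) * Q n x)) ∂(mixingLaw ψ β)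
      = 1 - z n := by
    intro n
    rw [integral_sub (integrable_const 1)]
    · simp [z]
    · have := hQm n
      refine Integrable.of_bound (C := 1) (by fun_prop : Measurable
        fun x : ℝ => Complex.exp ((lam / (1 - x) : ℝ) * Q n x)).aestronglyMeasurable ?_
      have : ∀ᵐ x ∂(mixingLaw ψ β), x ∈ Set.Ioo (0 : ℝ) 1 :=
        (withDensity_absolutelyContinuous _ _).ae_le (ae_restrict_mem measurableSet_Ioo)
      exact this.mono (hQexp n)
  have hlim := tendsto_one_add_pow_exp_of_tendsto_mul hN' (g := fun n => z n - 1)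
    (t := -((stableConst ψ₁ lam β * |∑ i, θ i * t i| ^ (2 * (1 + β)) : ℝ) : ℂ)) (by
      refine key.neg.congr fun n => ?_
      rw [hz, Complex.real_smul]
      simp only [hM_def]
      rw [← Real.rpow_mul (Nat.cast_nonneg _), one_div_mul_cancel h1β.ne', Real.rpow_one]
      push_cast
      ring)
  rw [← Complex.ofReal_neg, ← Complex.ofReal_exp] at hlim
  refine hlim.congr fun n => ?_
  rw [integral_exp_sum_aggregate hlam.le hα hX₀ hcopy hindep (N n) n t θ, hα₀, add_sub_cancel]

/-! ### Lévy's theorem and the stable law -/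

/-- A pointwise limit of characteristic functions that is continuous at `0` is a characteristic
function. -/
lemma exists_charFun_eq_of_tendsto {E : Type*} [NormedAddCommGroup E] [InnerProductSpace ℝ E]
    [FiniteDimensional ℝ E] [MeasurableSpace E] [BorelSpace E]
    {μ : ℕ → ProbabilityMeasure E} {f : E → ℂ} (hf : ContinuousAt f 0)
    (h : ∀ t, Tendsto (fun n => charFun (μ n) t) atTop (𝓝 (f t))) :
    ∃ ν : ProbabilityMeasure E, ∀ t, charFun ν t = f t := by
  have htight := isTightMeasureSet_of_tendsto_charFun (μ := fun n => (μ n : Measure E)) hf h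
  have hcomp : IsCompact (closure (Set.range μ)) := by
    refine isCompact_closure_of_isTightMeasureSet ?_
    convert htight using 1
    ext x
    simp
  -- Compactness gives a limit along a free ultrafilter, which replaces a convergent subsequence.
  -- The pointwise limit of the characteristic functions identifies it.
  obtain ⟨ν, -, hν⟩ := hcomp.ultrafilter_le_nhds ((hyperfilter ℕ).map μ) (by
    rw [le_principal_iff]
    exact mem_map.2 (univ_mem' fun n => subset_closure (Set.mem_range_self n)))
  refine ⟨ν, fun t => ?_⟩
  have h1 : Tendsto μ (hyperfilter ℕ) (𝓝 ν) := hν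
  rw [ProbabilityMeasure.tendsto_iff_forall_integral_rclike_tendsto ℂ] at h1
  have h2 := h1 (BoundedContinuousFunction.innerProbChar t)
  simp_rw [← charFun_eq_integral_innerProbChar] at h2
  exact tendsto_nhds_unique h2 ((h t).mono_left Nat.hyperfilter_le_atTop)

/-- The law with characteristic function `exp (-(K |θ| ^ γ))` is symmetric `γ`-stable. -/
lemma isSymmetricStable_of_charFun {γ K : ℝ} (hγ : 0 < γ) (hγ2 : γ ≤ 2) (hK : 0 < K)
    {ν : Measure ℝ} [IsProbabilityMeasure ν]
    (hν : ∀ θ : ℝ, charFun ν θ = (Real.exp (-(K * |θ| ^ γ)) : ℂ)) :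
    IsSymmetricStable γ ν where
  index_pos := hγ
  index_le_two := hγ2
  -- The characteristic function of a Dirac mass has modulus one everywhere, whereas here it equals
  -- `exp (-K) < 1` at `1`.
  nondegenerate x hx := by
    have h1 := hν 1
    rw [hx, charFun_dirac] at h1
    have h2 := congrArg norm h1
    rw [Complex.norm_exp_ofReal_mul_I, Complex.norm_real, Real.norm_of_nonneg (Real.exp_pos _).le,
      abs_one, Real.one_rpow, mul_one, eq_comm, Real.exp_eq_one_iff] at h2
    linarith
  symmetric := by
    have hm : Measurable fun x : ℝ => -x := measurable_neg
    have := Measure.isProbabilityMeasure_map (μ := ν) hm.aemeasurable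
    refine Measure.ext_of_charFun (funext fun θ => ?_)
    have e : (fun x : ℝ => -x) = fun x => (-1) * x := by ext; ring
    rw [e, charFun_map_mul, hν, hν]
    simp
  stable a b ha hb := by
    have hab : 0 < a ^ γ + b ^ γ := by positivity
    refine ⟨(a ^ γ + b ^ γ) ^ (1 / γ), 0, by positivity, ?_, ?_⟩
    · rw [← Real.rpow_mul hab.le, one_div_mul_cancel hγ.ne', Real.rpow_one]
    set c := (a ^ γ + b ^ γ) ^ (1 / γ) with hc
    have hc0 : 0 < c := by positivity
    have hcγ : c ^ γ = a ^ γ + b ^ γ := by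
      rw [hc, ← Real.rpow_mul hab.le, one_div_mul_cancel hγ.ne', Real.rpow_one]
    have hm : Measurable fun p : ℝ × ℝ => a * p.1 + b * p.2 := by fun_prop
    have hm' : Measurable fun x : ℝ => c * x := by fun_prop
    simp only [add_zero]
    have := Measure.isProbabilityMeasure_map (μ := ν.prod ν) hm.aemeasurable
    have := Measure.isProbabilityMeasure_map (μ := ν) hm'.aemeasurable
    refine Measure.ext_of_charFun (funext fun θ => ?_)
    have h1 : charFun ((ν.prod ν).map fun p => a * p.1 + b * p.2) θ
        = charFun ν (a * θ) * charFun ν (b * θ) := by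
      rw [charFun_apply_real, integral_map hm.aemeasurable (by fun_prop), charFun_apply_real,
        charFun_apply_real, ← integral_prod_mul]
      congr 1 with p
      rw [← Complex.exp_add]
      congr 1
      push_cast
      ring
    rw [h1, charFun_map_mul, hν, hν, hν, ← Complex.ofReal_mul, ← Real.exp_add]
    congr 2
    rw [abs_mul, abs_mul, abs_mul, Real.mul_rpow (abs_nonneg _) (abs_nonneg _),
      Real.mul_rpow (abs_nonneg _) (abs_nonneg _), Real.mul_rpow (abs_nonneg _) (abs_nonneg _),
      abs_of_pos ha, abs_of_pos hb, abs_of_pos hc0, hcγ]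
    ring

lemma charFun_map_toLp {Ω ι : Type*} [Fintype ι] [MeasurableSpace Ω] {Q : Measure Ω}
    {Z : Ω → ι → ℝ} (hZ : AEMeasurable Z Q) (θ : EuclideanSpace ℝ ι) :
    charFun (Q.map fun ω => (WithLp.toLp 2 (Z ω) : EuclideanSpace ℝ ι)) θ
      = ∫ ω, Complex.exp ((∑ i, θ i * Z ω i : ℝ) * Complex.I) ∂Q := by
  have hE : Measurable (WithLp.toLp 2 : (ι → ℝ) → EuclideanSpace ℝ ι) :=
    (PiLp.continuous_toLp 2 _).measurable
  have hZ' : AEMeasurable (fun ω => (WithLp.toLp 2 (Z ω) : EuclideanSpace ℝ ι)) Q :=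
    hE.comp_aemeasurable hZ
  rw [charFun_apply, integral_map hZ' (by fun_prop)]
  simp [PiLp.inner_apply]

/-- Convergence in distribution of random vectors from the convergence of the characteristic
functions. -/
lemma tendstoInDistribution_of_tendsto_integral_exp_sum {Ω Ω' ι : Type*} [Fintype ι]
    [MeasurableSpace Ω] [MeasurableSpace Ω'] {P : Measure Ω} [IsProbabilityMeasure P]
    {Q : Measure Ω'} [IsProbabilityMeasure Q] {Y : ℕ → Ω → ι → ℝ} {Z : Ω' → ι → ℝ}
    (hY : ∀ n, AEMeasurable (Y n) P) (hZ : AEMeasurable Z Q)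
    (h : ∀ θ : ι → ℝ, Tendsto
      (fun n => ∫ ω, Complex.exp ((∑ i, θ i * Y n ω i : ℝ) * Complex.I) ∂P) atTop
      (𝓝 (∫ ω, Complex.exp ((∑ i, θ i * Z ω i : ℝ) * Complex.I) ∂Q))) :
    TendstoInDistribution Y atTop Z (fun _ => P) Q := by
  have hE : Measurable (WithLp.toLp 2 : (ι → ℝ) → EuclideanSpace ℝ ι) :=
    (PiLp.continuous_toLp 2 _).measurable
  -- Characteristic functions live on an inner product space, so the vectors are moved to
  -- `EuclideanSpace` and brought back by continuous mapping.
  have key : TendstoInDistribution (fun n ω => (WithLp.toLp 2 (Y n ω) : EuclideanSpace ℝ ι)) atTop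
      (fun ω => WithLp.toLp 2 (Z ω)) (fun _ => P) Q :=
    { forall_aemeasurable := fun n => hE.comp_aemeasurable (hY n)
      aemeasurable_limit := hE.comp_aemeasurable hZ
      tendsto := by
        refine ProbabilityMeasure.tendsto_iff_tendsto_charFun.2 fun θ => ?_
        have h1 := h θ
        rw [← charFun_map_toLp hZ θ] at h1
        exact h1.congr fun n => (charFun_map_toLp (hY n) θ).symm }
  exact key.continuous_comp (PiLp.continuous_ofLp 2 _)

end

/-! ### Conclusion -/

theorem theorem1
    {Ω₀ Ω : Type*} [MeasurableSpace Ω₀] [MeasurableSpace Ω]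
    (P₀ : Measure Ω₀) [IsProbabilityMeasure P₀]
    (P : Measure Ω) [IsProbabilityMeasure P]
    -- the parameters and the mixing density
    (lam β ψ₁ : ℝ) (hlam : 0 < lam) (hβ : -1 < β) (hβ' : β < 0) (hψ₁ : 0 < ψ₁)
    (ψ : ℝ → ℝ) (hψ_meas : AEMeasurable ψ (volume.restrict (Set.Ioo (0 : ℝ) 1)))
    (hψ_nonneg : ∀ x ∈ Set.Ioo (0 : ℝ) 1, 0 ≤ ψ x)
    (hψ_lim : Tendsto ψ (𝓝[<] 1) (𝓝 ψ₁))
    -- the randomized INAR(1) process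
    (α₀ : Ω₀ → ℝ) (ξ : ℕ → ℕ → Ω₀ → ℕ) (ε : ℕ → Ω₀ → ℕ) (X₀ : ℕ → Ω₀ → ℕ)
    (hα₀ : P₀.map α₀ = mixingLaw ψ β)
    (hX₀ : IsRandomizedINAR1 P₀ lam α₀ ξ ε X₀)
    -- its independent copies
    (α : ℕ → Ω → ℝ) (X : ℕ → ℕ → Ω → ℕ)
    (hcopy : ∀ j, IdentDistrib (fun ω => (α j ω, fun k => X j k ω))
      (fun ω => (α₀ ω, fun k => X₀ k ω)) P P₀)
    (hindep : iIndepFun (fun j ω => (α j ω, fun k => X j k ω)) P)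
    -- the numbers of copies
    (N : ℕ → ℕ)
    (hN : Tendsto (fun n : ℕ => (N n : ℝ) ^ (-β / (1 + β)) * (n : ℝ)⁻¹) atTop atTop) :
    ∃ (ν : Measure ℝ) (_ : IsProbabilityMeasure ν),
      IsSymmetricStable (2 * (1 + β)) ν ∧
      (∀ θ : ℝ, charFun ν θ =
        (Real.exp (-(stableConst ψ₁ lam β * |θ| ^ (2 * (1 + β)))) : ℂ)) ∧
      TendstoFDD
        (fun n t ω => (n : ℝ)⁻¹ * (N n : ℝ) ^ (-1 / (2 * (1 + β))) * aggregate lam α X (N n) n t ω)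
        P (fun t v => v * t) ν := by
  have hγ : 0 < 2 * (1 + β) := by linarith
  have hK : 0 < stableConst ψ₁ lam β :=
    mul_pos (mul_pos hψ₁ (Real.rpow_pos_of_pos (by linarith) _))
      (div_pos (Real.Gamma_pos_of_pos (by linarith)) (by linarith))
  have hYm : ∀ (n : ℕ) t, AEMeasurable (fun ω => (n : ℝ)⁻¹ * (N n : ℝ) ^ (-1 / (2 * (1 + β)))
      * aggregate lam α X (N n) n t ω) P := fun n t =>
    (aemeasurable_aggregate hcopy (N n) n t).const_mul _
  -- The law of `V` is constructed as the limit law of the normalised aggregate at time `1`.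
  obtain ⟨ν, hν⟩ := exists_charFun_eq_of_tendsto
    (μ := fun n : ℕ => ⟨P.map fun ω => (n : ℝ)⁻¹ * (N n : ℝ) ^ (-1 / (2 * (1 + β)))
      * aggregate lam α X (N n) n 1 ω, Measure.isProbabilityMeasure_map (hYm n 1)⟩)
    (f := fun θ : ℝ => (Real.exp (-(stableConst ψ₁ lam β * |θ| ^ (2 * (1 + β)))) : ℂ))
    (by
      have : Continuous fun θ : ℝ => |θ| ^ (2 * (1 + β)) :=
        continuous_abs.rpow_const fun _ => Or.inr hγ.le
      exact (Complex.continuous_ofReal.comp (Real.continuous_exp.comp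
        (this.const_mul _).neg)).continuousAt)
    (fun θ => by
      have h := tendsto_integral_exp_sum_aggregate hlam hβ hβ' hψ_meas hψ_nonneg hψ_lim hα₀ hX₀
        hcopy hindep hN (fun _ : Unit => 1) (fun _ => θ)
      simp only [Finset.univ_unique, Finset.sum_singleton, NNReal.coe_one, mul_one] at h
      refine h.congr fun n => ?_
      rw [ProbabilityMeasure.coe_mk, charFun_apply_real, integral_map (hYm n 1) (by fun_prop)]
      simp only [Complex.ofReal_mul])
  refine ⟨ν, inferInstance, isSymmetricStable_of_charFun hγ (by linarith) hK hν, hν, fun I => ?_⟩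
  refine tendstoInDistribution_of_tendsto_integral_exp_sum
    (fun n => aemeasurable_pi_lambda _ fun t => hYm n t) (by fun_prop) fun θ => ?_
  have h := tendsto_integral_exp_sum_aggregate hlam hβ hβ' hψ_meas hψ_nonneg hψ_lim hα₀ hX₀
    hcopy hindep hN (fun t : I => (t : ℝ≥0)) θ
  -- Along the random line the exponent is `v * ∑ θ t * t`, so the joint characteristic function is
  -- that of `ν` at a single point.
  have e : ∫ v, Complex.exp ((∑ t : I, θ t * (v * (t : ℝ≥0)) : ℝ) * Complex.I) ∂(ν : Measure ℝ)
      = (Real.exp (-(stableConst ψ₁ lam β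
        * |∑ t : I, θ t * (t : ℝ≥0)| ^ (2 * (1 + β)))) : ℂ) := by
    rw [← hν, charFun_apply_real]
    congr 1 with v
    rw [← Complex.ofReal_mul, Finset.sum_mul]
    congr 3
    exact Finset.sum_congr rfl fun t _ => by ring
  rw [e]
  exact h
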